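/- Let $d\ge 1$, let $L\ge 2$ be even, $\beta>0$, $u\in[0,\frac12]$ and $\theta\in\{2,3,4,\dots\}$. Let $\Lambda=(\mathbb Z/L\mathbb Z)^d$ and let $\mathcal E$ be the set of unordered pairs of nearest neighbours of $\Lambda$. Let $\rho$ be the law of the Poisson point process on $\mathcal E\times[0,\beta]$ with two kinds of transitions: crosses, with intensity $u$, and double bars, with intensity $1-u$ (with respect to counting measure on $\mathcal E$ times Lebesgue measure on $[0,\beta]$). For a realization $\xi$ let $\Sigma(\xi)$ be the set of space-time spin configurations $\sigma:\Lambda\times[0,\beta]_{\rm per}\to\{1,\dots,\theta\}$, piecewise constant and càdlàg in the periodic time variable, such that * if $\xi$ has a cross at $(\{x,y\},t)$, then $\sigma_{x,t+}=\sigma_{y,t-}$ and $\sigma_{y,t+}=\sigma_{x,t-}$; * if $\xi$ has a double bar at $(\{x,y\},t)$, then $\sigma_{x,t+}=\sigma_{y,t+}$ and $\sigma_{x,t-}=\sigma_{y,t-}$; * $t\mapsto\sigma_{x,t}$ is constant away from the times of the transitions on edges that contain $x$. Let $\vec a_1,\dots,\vec a_\theta\in\mathbb R^{\theta-1}$ be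 any vectors (the vertices of a regular simplex) with $\|\vec a_p-\vec a_q\|=1$ and $\vec a_p\cdot\vec a_q=-\frac1{2\theta}$ for $p\ne q$, $\|\vec a_p\|^2=\frac{\theta-1}{2\theta}$, and $\sum_q\vec a_p\cdot\vec a_q=0$ for every $p$. Write $\vec\sigma_{xt}=\vec a_{\sigma_{xt}}$, and let $\vec\sigma^{(1)}_{xt}$ be its first component. For a field $v:\Lambda\to\mathbb R$ let $$Z(v)=\int d\rho(\xi)\sum_{\sigma\in\Sigma(\xi)}\exp\Bigl\{-\sum_{\{x,y\}\in\mathcal E}\int_0^\beta dt\,\Bigl[(\vec\sigma^{(1)}_{xt}-\vec\sigma^{(1)}_{yt})(v_x-v_y)+\tfrac14(v_x-v_y)^2\Bigr]\Bigr\}.$$ For $i\in\{1,\dots,d\}$ and $m\in\mathbb Z/L\mathbb Z$ let $R$ be the reflection of $\Lambda$ across the edges $\{x,y\}$ with $x_i=m$, $y_i=m+1$; it replaces the coordinate $x_i$ by $2m+1-x_i$ and keeps the others. Let $\Lambda^{(1)}=\{x: x_i\in\{m-\frac L2+1,\dots,m\}\}$ and $\Lambda^{(2)}=\{x: x_i\in\{m+1,\dots,m+\frac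 L2\}\}$ be the two halves, which $R$ exchanges. For fields $v^{(1)}$ on $\Lambda^{(1)}$ and $v^{(2)}$ on $\Lambda^{(2)}$ let $(v^{(1)},v^{(2)})$ be the field on $\Lambda$ with these restrictions, let $Rv^{(1)}$ be the field on $\Lambda^{(2)}$ with $(Rv^{(1)})_x=v^{(1)}_{Rx}$, and let $Rv^{(2)}$ be the field on $\Lambda^{(1)}$ with $(Rv^{(2)})_x=v^{(2)}_{Rx}$. Then $Z(v)<\infty$ for every $v:\Lambda\to\mathbb R$, and for every such reflection $R$ and all fields $v^{(1)}$ on $\Lambda^{(1)}$ and $v^{(2)}$ on $\Lambda^{(2)}$, $$Z(v^{(1)},v^{(2)})^2\le Z(v^{(1)},Rv^{(1)})\,Z(Rv^{(2)},v^{(2)}).$$ -/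

import Mathlib

open scoped ENNReal Topology Nat

noncomputable section

namespace RandomLoops

/-! ### The simplex embedding of the spin values -/

/-- The points `a q`, `q ∈ Fin θ`, are the vertices of a centred regular simplex with `θ` vertices
and unit side length in `ℝ^(θ-1)`.  With `θ = 2S+1` the squared norm is `S/(2S+1)`. -/
structure IsSimplexEmbedding {θ : ℕ} (a : Fin θ → EuclideanSpace ℝ (Fin (θ - 1))) : Prop where
  norm_sub : ∀ p q, p ≠ q → ‖a p - a q‖ = 1
  inner_eq : ∀ p q, p ≠ q → inner ℝ (a p) (a q) = -1 / (2 * (θ : ℝ))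
  norm_sq : ∀ p, ‖a p‖ ^ 2 = ((θ : ℝ) - 1) / (2 * θ)
  sum_inner : ∀ p, ∑ q, inner ℝ (a p) (a q) = 0

/-- The first component of the vectors of a simplex embedding. -/
def firstComponent {θ : ℕ} (hθ : 2 ≤ θ) (a : Fin θ → EuclideanSpace ℝ (Fin (θ - 1)))
    (q : Fin θ) : ℝ :=
  a q ⟨0, by omega⟩

/-! ### Poisson point processes with finite intensity measure -/

/-- The law of the Poisson point process with finite intensity measure `m`: a realization consists
of `n` points `x₁, …, xₙ`, and it has weight `exp (-m(X)) / n! · m(dx₁) ⋯ m(dxₙ)`. -/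
def poissonProcess {X : Type*} [MeasurableSpace X] (m : MeasureTheory.Measure X) :
    MeasureTheory.Measure (Σ n : ℕ, (Fin n → X)) :=
  MeasureTheory.Measure.sum fun n : ℕ =>
    ENNReal.ofReal (Real.exp (-(m Set.univ).toReal) / (n ! : ℝ)) •
      (MeasureTheory.Measure.pi fun _ : Fin n => m).map (Sigma.mk n)

/-! ### Transitions on a graph -/

/-- The two kinds of transitions. -/
inductive Kind
  | cross
  | doubleBar

instance : MeasurableSpace Kind := ⊤

instance edgeMeasurableSpace {V : Type*} (G : SimpleGraph V) : MeasurableSpace G.edgeSet := ⊤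

/-- The allowed local configurations `(σ_{x,t+}, σ_{y,t+}, σ_{x,t-}, σ_{y,t-})` at a transition
on the edge `{x,y}`: `(a,b,b,a)` for a cross, and `(b,b,a,a)` for a double bar.  Both sets are
invariant under the exchange of `x` and `y`. -/
def Kind.allowed (θ : ℕ) : Kind → Set (Fin θ × Fin θ × Fin θ × Fin θ)
  | .cross => {q | ∃ a b, q = (a, b, b, a)}
  | .doubleBar => {q | ∃ a b, q = (b, b, a, a)}

/-- Intensities: `u` for the crosses and `1 - u` for the double bars. -/
def kindMeasure (u : ℝ) : MeasureTheory.Measure Kind :=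
  ENNReal.ofReal u • MeasureTheory.Measure.dirac Kind.cross +
    ENNReal.ofReal (1 - u) • MeasureTheory.Measure.dirac Kind.doubleBar

/-- A marked space-time point: an edge, a time, and the kind of the transition. -/
abbrev Transition {V : Type*} (G : SimpleGraph V) : Type _ := G.edgeSet × ℝ × Kind

/-- The intensity measure on `ℰ × [0,β] × {cross, double bar}`. -/
def intensity {V : Type*} (G : SimpleGraph V) (β u : ℝ) :
    MeasureTheory.Measure (Transition G) :=
  MeasureTheory.Measure.count.prod
    ((MeasureTheory.volume.restrict (Set.Icc 0 β)).prod (kindMeasure u))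

/-- Realizations of the Poisson point process: finite families of transitions. -/
abbrev Realization {V : Type*} (G : SimpleGraph V) : Type _ := Σ n : ℕ, (Fin n → Transition G)

/-! ### Space-time spin configurations -/

/-- Space-time spin configurations `Λ × [0,β]_per → {spin values}`, as `β`-periodic functions of
time.  The spin values are discrete, so the two local conditions say that `t ↦ σ x t` is càdlàg,
and by compactness it is then piecewise constant with finitely many jumps in a period. -/
structure SpinConfig (V : Type*) (θ : ℕ) (β : ℝ) where
  val : V → ℝ → Fin θ
  periodic : ∀ x, Function.Periodic (val x) β
  right_cont : ∀ x t, ∀ᶠ s in 𝓝[>] t, val x s = val x t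
  left_lim : ∀ x t, ∃ q, ∀ᶠ s in 𝓝[<] t, val x s = q

/-- `σ` is compatible with the realization `ξ`: at each transition the local configuration is
allowed, and at all other space-time points `σ` is locally constant in time. -/
def Compatible {V : Type*} {G : SimpleGraph V} {θ : ℕ} {β : ℝ}
    (ξ : Realization G) (σ : SpinConfig V θ β) : Prop :=
  (∀ j, ∀ x y, ((ξ.2 j).1 : Sym2 V) = s(x, y) →
    ∀ᶠ s in 𝓝[<] (ξ.2 j).2.1,
      (σ.val x (ξ.2 j).2.1, σ.val y (ξ.2 j).2.1, σ.val x s, σ.val y s)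
        ∈ (ξ.2 j).2.2.allowed θ) ∧
  (∀ x t, (∀ j, x ∈ ((ξ.2 j).1 : Sym2 V) → ¬ (ξ.2 j).2.1 ≡ t [PMOD β]) →
    ∀ᶠ s in 𝓝 t, σ.val x s = σ.val x t)

/-! ### The partition function with external fields -/

/-- The contribution
`∫₀^β [(σ⁽¹⁾_{xt} - σ⁽¹⁾_{yt}) (v_x - v_y) + (v_x - v_y)² / 4] dt` of the edge `{x,y}`, where
`f q` is the first component of the vector that represents the spin value `q`. -/
def edgeEnergy {V : Type*} {θ : ℕ} {β : ℝ} (f : Fin θ → ℝ) (v : V → ℝ) (σ : SpinConfig V θ β) :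
    Sym2 V → ℝ :=
  Sym2.lift ⟨fun x y => ∫ t in (0 : ℝ)..β,
      ((f (σ.val x t) - f (σ.val y t)) * (v x - v y) + 1 / 4 * (v x - v y) ^ 2), by
    intro x y
    refine intervalIntegral.integral_congr fun t _ => ?_
    ring⟩

/-- The partition function
`Z(v) = ∫ dρ(ξ) ∑_{σ ∈ Σ(ξ)} exp {- ∑_{x,y} ∫₀^β [⋯] dt}`, as an element of `[0,∞]`. -/
def partitionFunction {V : Type*} (G : SimpleGraph V) [Fintype G.edgeSet] {θ : ℕ} (β u : ℝ)
    (f : Fin θ → ℝ) (v : V → ℝ) : ℝ≥0∞ :=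
  ∫⁻ ξ : Realization G,
    ∑' σ : {σ : SpinConfig V θ β // Compatible ξ σ},
      ENNReal.ofReal (Real.exp (-∑ e : G.edgeSet, edgeEnergy f v σ.1 (e : Sym2 V)))
    ∂(poissonProcess (intensity G β u))

/-! ### The torus and its reflections -/

/-- The torus `(ℤ/Lℤ)^d` with nearest-neighbour edges. -/
def torus (d L : ℕ) : SimpleGraph (Fin d → ZMod L) :=
  SimpleGraph.fromRel fun x y => ∃ i, y = x + Pi.single i 1

instance torusFintypeEdgeSet (d L : ℕ) [NeZero L] : Fintype (torus d L).edgeSet :=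
  Fintype.ofFinite _

/-- The reflection in direction `i` across the edges `{x,y}` with `x_i = m`, `y_i = m + 1`, that is,
across `ℓ = m + 1/2`; it maps `x_i` to `2 ℓ - x_i = 2 m + 1 - x_i`. -/
def reflect {d L : ℕ} (i : Fin d) (m : ZMod L) (x : Fin d → ZMod L) : Fin d → ZMod L :=
  Function.update x i (2 * m + 1 - x i)

/-- The sites to the left of the reflection plane: `x_i ∈ {m - L/2 + 1, …, m}`. -/
def leftHalf {d L : ℕ} (i : Fin d) (m : ZMod L) : Set (Fin d → ZMod L) :=
  {x | (m - x i).val < L / 2}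

/-- The sites to the right of the reflection plane: `x_i ∈ {m + 1, …, m + L/2}`. -/
def rightHalf {d L : ℕ} (i : Fin d) (m : ZMod L) : Set (Fin d → ZMod L) :=
  {x | (x i - (m + 1)).val < L / 2}

theorem mem_rightHalf_of_notMem_leftHalf {d L : ℕ} [NeZero L] (hL : Even L) {i : Fin d}
    {m : ZMod L} {x : Fin d → ZMod L} (hx : x ∉ leftHalf i m) : x ∈ rightHalf i m := by
  obtain ⟨k, hk⟩ := hL
  have hL0 : L ≠ 0 := NeZero.ne L
  simp only [leftHalf, rightHalf, Set.mem_ofPred_eq, not_lt] at hx ⊢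
  have hlt := ZMod.val_lt (m - x i)
  have h : x i - (m + 1) = ((L - 1 - (m - x i).val : ℕ) : ZMod L) := by
    rw [Nat.cast_sub (by omega), Nat.cast_sub (by omega), ZMod.natCast_zmod_val]
    simp only [CharP.cast_eq_zero, Nat.cast_one]
    ring
  rw [h, ZMod.val_natCast_of_lt (by omega)]
  omega

theorem reflect_mem_leftHalf {d L : ℕ} {i : Fin d} {m : ZMod L} {x : Fin d → ZMod L}
    (hx : x ∈ rightHalf i m) : reflect i m x ∈ leftHalf i m := by
  simp only [leftHalf, rightHalf, reflect, Set.mem_ofPred_eq, Function.update_self] at hx ⊢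
  rwa [show m - (2 * m + 1 - x i) = x i - (m + 1) by ring]

theorem reflect_mem_rightHalf {d L : ℕ} {i : Fin d} {m : ZMod L} {x : Fin d → ZMod L}
    (hx : x ∈ leftHalf i m) : reflect i m x ∈ rightHalf i m := by
  simp only [leftHalf, rightHalf, reflect, Set.mem_ofPred_eq, Function.update_self] at hx ⊢
  rwa [show 2 * m + 1 - x i - (m + 1) = m - x i by ring]

/-- The field `R v₁` on the right half, `(R v₁)_x = (v₁)_{R x}`. -/
def reflectLeft {d L : ℕ} {i : Fin d} {m : ZMod L} (v₁ : leftHalf i m → ℝ) :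
    rightHalf i m → ℝ :=
  fun x => v₁ ⟨reflect i m x, reflect_mem_leftHalf x.2⟩

/-- The field `R v₂` on the left half, `(R v₂)_x = (v₂)_{R x}`. -/
def reflectRight {d L : ℕ} {i : Fin d} {m : ZMod L} (v₂ : rightHalf i m → ℝ) :
    leftHalf i m → ℝ :=
  fun x => v₂ ⟨reflect i m x, reflect_mem_rightHalf x.2⟩

open Classical in
/-- The field `(v₁, v₂)` on the torus with restrictions `v₁` and `v₂` to the two halves. -/
def glue {d L : ℕ} [NeZero L] (hL : Even L) {i : Fin d} {m : ZMod L}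
    (v₁ : leftHalf i m → ℝ) (v₂ : rightHalf i m → ℝ) : (Fin d → ZMod L) → ℝ :=
  fun x => if hx : x ∈ leftHalf i m then v₁ ⟨x, hx⟩
    else v₂ ⟨x, mem_rightHalf_of_notMem_leftHalf hL hx⟩

/-- The partition function `Z(v)` on the torus with side length `L` in dimension `d`, for the
embedding `a` of the spin values. -/
def torusPartitionFunction {d L θ : ℕ} [NeZero L] (hθ : 2 ≤ θ) (β u : ℝ)
    (a : Fin θ → EuclideanSpace ℝ (Fin (θ - 1))) (v : (Fin d → ZMod L) → ℝ) : ℝ≥0∞ :=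
  partitionFunction (torus d L) β u (firstComponent hθ a) v

end RandomLoops

end

/-! The partition function is the trace of a matrix exponential, and the generator of that
exponential has a sign structure under reflection that permits a Cauchy–Schwarz inequality.

Feynman–Kac (`partitionFunction_eq`): `Z(v) = exp (-|ℰ| β) · Tr exp (β K)`, where `K` acts on
functions of a spin configuration and sums, over edges, `u` times the cross matrix plus `1 - u`
times the double-bar matrix minus the field energy. Fix `c` above the energy and expand `exp ∫ (c -
energy)` in powers. Its terms insert diagonal matrices at further uniform times, so transitions and
insertions together form one family of times. For almost every family the sum over configurations is
the trace of the time-ordered product of matrices. Adding over labels and over the split of `N`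
points into `n` transitions and `k` insertions gives `∑ β^N / N! · Tr (K + c)^N`; the shift `c` then
cancels. In particular `Z(v)` is finite.

Reflection: identifying the right half with the left one by `R`, `K = A(w₁) ⊗ 1 + 1 ⊗ A(w₂) + X(w₁,
w₂)`, where `w₁`, `w₂` are the two half-fields. The claim is that `X = ∑ᵢ Cᵢ(w₁) ⊗ Cᵢ(w₂)` with real
`Cᵢ` (`pairTerm_inl_inr`). With matrix units `E_pq`, the off-diagonal part on a crossing edge is
`∑_{p≠q} [u E_pq ⊗ E_qp + (1-u) E_pq ⊗ E_pq] = ∑_{p≠q} [u/2 (E_pq + E_qp)^{⊗2} + (1-2u) E_pq^{⊗2}]`,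
which is where `u ≤ 1/2` enters. The diagonal part is `δ_{pq} = 2 a_p · a_q + 1/θ`; its
first-component term completes the square with the field, leaving `½ (w₁ + 2 f(p)) (w₂ + 2 f(q))`
plus one-sided terms.

Sums, products and nonnegative multiples of such `X` have the same form, and `Tr (C ⊗ D) = Tr C · Tr
D`, so Cauchy–Schwarz over `i` applies to every partial sum of the exponential series. The one-sided
terms are absorbed by writing `A ⊗ 1 + 1 ⊗ A'` as `ε⁻¹ [(1 + εA) ⊗ (1 + εA') - 1]` up to `O(ε)` and
letting `ε → 0` (`trace_exp_sq_le_of_isReflectionPositive`). -/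

noncomputable section

namespace RandomLoops

open MeasureTheory

/-! ### Spin configurations with jumps at prescribed times -/

namespace SpinConfig

variable {V : Type*} {θ : ℕ} {β : ℝ}

theorem ext_val {σ σ' : SpinConfig V θ β} (h : ∀ x t, σ.val x t = σ'.val x t) : σ = σ' := by
  cases σ; cases σ'
  congr
  exact funext fun x => funext fun t => h x t

/-- The configuration at time `t`. -/
def conf (σ : SpinConfig V θ β) (t : ℝ) : V → Fin θ := fun x => σ.val x t

/-- The left limit of the configuration at time `t`. -/
def leftConf (σ : SpinConfig V θ β) (t : ℝ) : V → Fin θ := fun x => (σ.left_lim x t).choose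

theorem eventually_leftConf (σ : SpinConfig V θ β) (x : V) (t : ℝ) :
    ∀ᶠ s in 𝓝[<] t, σ.val x s = σ.leftConf t x :=
  (σ.left_lim x t).choose_spec

theorem leftConf_eq {σ : SpinConfig V θ β} {x : V} {t : ℝ} {q : Fin θ}
    (h : ∀ᶠ s in 𝓝[<] t, σ.val x s = q) : σ.leftConf t x = q := by
  obtain ⟨s, h₁, h₂⟩ := (h.and (σ.eventually_leftConf x t)).exists
  exact h₂.symm.trans h₁

theorem eventually_nhds_iff (σ : SpinConfig V θ β) (x : V) (t : ℝ) :
    (∀ᶠ s in 𝓝 t, σ.val x s = σ.val x t) ↔ σ.leftConf t x = σ.conf t x := by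
  refine ⟨fun h => leftConf_eq (h.filter_mono nhdsWithin_le_nhds), fun h => ?_⟩
  have h₁ := σ.eventually_leftConf x t
  rw [h] at h₁
  have h₂ := σ.right_cont x t
  rw [eventually_nhdsWithin_iff] at h₁ h₂
  filter_upwards [h₁, h₂] with s hs₁ hs₂
  rcases lt_trichotomy s t with hs | rfl | hs
  · exact hs₁ hs
  · rfl
  · exact hs₂ hs

theorem val_toIcoMod (σ : SpinConfig V θ β) (hβ : 0 < β) (x : V) (t : ℝ) :
    σ.val x (toIcoMod hβ 0 t) = σ.val x t := by
  rw [toIcoMod]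
  exact (σ.periodic x).sub_zsmul_eq _

theorem eventually_nhds_of_modEq (σ : SpinConfig V θ β) {s t : ℝ} (h : s ≡ t [PMOD β]) (x : V)
    (hs : ∀ᶠ r in 𝓝 s, σ.val x r = σ.val x s) : ∀ᶠ r in 𝓝 t, σ.val x r = σ.val x t := by
  obtain ⟨z, rfl⟩ := AddCommGroup.modEq_iff_eq_add_zsmul.1 h
  have hT : Filter.Tendsto (fun r => r - z • β) (𝓝 (s + z • β)) (𝓝 s) := by
    have h : Continuous fun r : ℝ => r - z • β := by fun_prop
    simpa using h.tendsto (s + z • β)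
  filter_upwards [hT.eventually hs] with r hr
  rw [((σ.periodic x).sub_zsmul_eq z)] at hr
  rw [hr, (σ.periodic x).zsmul z s]

/-- A continuous map from an interval to a discrete space is constant. The endpoint `a` may itself
be a jump time, since right continuity suffices there. -/
theorem val_eq_of_le (σ : SpinConfig V θ β) {x : V} {a b : ℝ} (hab : a ≤ b)
    (h : ∀ r ∈ Set.Ioc a b, ∀ᶠ s in 𝓝 r, σ.val x s = σ.val x r) : σ.val x b = σ.val x a := by
  have hc : ContinuousOn (σ.val x) (Set.Icc a b) := by
    intro r hr
    rcases hr.1.eq_or_lt with rfl | h₁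
    · have : ∀ᶠ s in 𝓝[Set.Icc a b] a, σ.val x s = σ.val x a := by
        have h₂ := σ.right_cont x a
        rw [eventually_nhdsWithin_iff] at h₂ ⊢
        filter_upwards [h₂] with s hs hs'
        rcases hs'.1.eq_or_lt with rfl | h₃
        · rfl
        · exact hs h₃
      exact tendsto_const_nhds.congr' (this.mono fun s hs => hs.symm)
    · exact (tendsto_const_nhds.congr' ((h r ⟨h₁, hr.2⟩).mono fun s hs => hs.symm)).mono_left
        nhdsWithin_le_nhds
  exact isPreconnected_Icc.constant hc ⟨hab, le_rfl⟩ ⟨le_rfl, hab⟩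

end SpinConfig

theorem eq_of_modEq_of_mem_Ico {β a b : ℝ} (hβ : 0 < β) (ha : a ∈ Set.Ico 0 β)
    (hb : b ∈ Set.Ico 0 β) (h : a ≡ b [PMOD β]) : a = b := by
  have := (toIcoMod_inj hβ (c := (0 : ℝ))).2 h
  rwa [(toIcoMod_eq_self hβ).2 (by simpa using ha), (toIcoMod_eq_self hβ).2 (by simpa using hb)]
    at this

/-- The configuration `σ` jumps only at the times `t j`, up to multiples of `β`. -/
def AdaptedTo {V J : Type*} {θ : ℕ} {β : ℝ} (t : J → ℝ) (σ : SpinConfig V θ β) : Prop :=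
  ∀ x r, (∀ j, ¬ t j ≡ r [PMOD β]) → ∀ᶠ s in 𝓝 r, σ.val x s = σ.val x r

/-! ### Step paths -/

/-- The number of times `t j` in `(-∞, r]`. -/
def crossed {N : ℕ} (t : Fin N → ℝ) (r : ℝ) : Fin (N + 1) :=
  ⟨(Finset.univ.filter fun j => t j ≤ r).card,
    Nat.lt_succ_of_le ((Finset.card_le_univ _).trans_eq (Fintype.card_fin N))⟩

/-- The number of times `t j` in `(-∞, r)`. -/
def crossedLeft {N : ℕ} (t : Fin N → ℝ) (r : ℝ) : Fin (N + 1) :=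
  ⟨(Finset.univ.filter fun j => t j < r).card,
    Nat.lt_succ_of_le ((Finset.card_le_univ _).trans_eq (Fintype.card_fin N))⟩

section Steps

variable {N : ℕ} (t : Fin N → ℝ)

theorem eventually_crossed_right (r : ℝ) : ∀ᶠ s in 𝓝[>] r, crossed t s = crossed t r := by
  have : ∀ j, ∀ᶠ s in 𝓝[>] r, (t j ≤ s ↔ t j ≤ r) := by
    intro j
    by_cases h : t j ≤ r
    · filter_upwards [self_mem_nhdsWithin] with s hs
      exact iff_of_true (h.trans (le_of_lt hs)) h
    · filter_upwards [mem_nhdsWithin_of_mem_nhds (Iio_mem_nhds (not_le.1 h))] with s hs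
      exact iff_of_false (not_le.2 hs) h
  filter_upwards [Filter.eventually_all.2 this] with s hs
  simp only [crossed, hs]

theorem eventually_crossed_left (r : ℝ) : ∀ᶠ s in 𝓝[<] r, crossed t s = crossedLeft t r := by
  have : ∀ j, ∀ᶠ s in 𝓝[<] r, (t j ≤ s ↔ t j < r) := by
    intro j
    by_cases h : t j < r
    · filter_upwards [mem_nhdsWithin_of_mem_nhds (Ioi_mem_nhds h)] with s hs
      exact iff_of_true (le_of_lt hs) h
    · filter_upwards [self_mem_nhdsWithin] with s hs
      exact iff_of_false (fun h' => h (h'.trans_lt hs)) h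
  filter_upwards [Filter.eventually_all.2 this] with s hs
  simp only [crossed, crossedLeft, hs]

theorem eventually_toIcoMod_right {β : ℝ} (hβ : 0 < β) (r : ℝ) :
    ∀ᶠ s in 𝓝[>] r, crossed t (toIcoMod hβ 0 s) = crossed t (toIcoMod hβ 0 r) := by
  obtain ⟨h₀, z, hz⟩ := (toIcoMod_eq_iff hβ (a := 0) (b := r)).1 rfl
  set ρ := toIcoMod hβ 0 r
  rw [zero_add] at h₀
  have hT : Filter.Tendsto (fun s => ρ + (s - r)) (𝓝[>] r) (𝓝[>] ρ) := by
    refine tendsto_nhdsWithin_iff.2 ⟨?_, ?_⟩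
    · have : Continuous fun s : ℝ => ρ + (s - r) := by fun_prop
      simpa using (this.tendsto r).mono_left nhdsWithin_le_nhds
    · filter_upwards [self_mem_nhdsWithin] with s hs
      have : r < s := hs
      simp only [Set.mem_Ioi]
      linarith
  filter_upwards [hT.eventually (eventually_crossed_right t ρ), self_mem_nhdsWithin,
    mem_nhdsWithin_of_mem_nhds (Iio_mem_nhds (show r < r + (β - ρ) by linarith [h₀.2]))]
    with s hs h₁ h₂
  have h₁' : r < s := h₁
  have h₂' : s < r + (β - ρ) := h₂
  rw [← hs]
  congr 1
  refine (toIcoMod_eq_iff hβ).2 ⟨⟨by linarith [h₀.1], by linarith⟩, z, by linarith⟩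

theorem eventually_toIcoMod_left {β : ℝ} (hβ : 0 < β) (r : ℝ) :
    ∀ᶠ s in 𝓝[<] r, crossed t (toIcoMod hβ 0 s) = crossedLeft t (toIocMod hβ 0 r) := by
  obtain ⟨h₀, z, hz⟩ := (toIocMod_eq_iff hβ (a := 0) (b := r)).1 rfl
  set ρ := toIocMod hβ 0 r
  rw [zero_add] at h₀
  have hT : Filter.Tendsto (fun s => ρ + (s - r)) (𝓝[<] r) (𝓝[<] ρ) := by
    refine tendsto_nhdsWithin_iff.2 ⟨?_, ?_⟩
    · have : Continuous fun s : ℝ => ρ + (s - r) := by fun_prop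
      simpa using (this.tendsto r).mono_left nhdsWithin_le_nhds
    · filter_upwards [self_mem_nhdsWithin] with s hs
      have : s < r := hs
      simp only [Set.mem_Iio]
      linarith
  filter_upwards [hT.eventually (eventually_crossed_left t ρ), self_mem_nhdsWithin,
    mem_nhdsWithin_of_mem_nhds (Ioi_mem_nhds (show r - ρ < r by linarith [h₀.1]))]
    with s hs h₁ h₂
  have h₁' : s < r := h₁
  have h₂' : r - ρ < s := h₂
  rw [← hs]
  congr 1
  refine (toIcoMod_eq_iff hβ).2 ⟨⟨by linarith, by linarith [h₀.2]⟩, z, by linarith⟩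

variable {t}

theorem lt_crossed_iff (ht : StrictMono t) {r : ℝ} {j : Fin N} :
    j.val < (crossed t r).val ↔ t j ≤ r := by
  constructor
  · intro h
    by_contra h'
    have : (Finset.univ.filter fun i => t i ≤ r) ⊆ Finset.Iio j := by
      intro i hi
      rw [Finset.mem_Iio]
      by_contra hij
      exact h' ((ht.monotone (not_lt.1 hij)).trans (Finset.mem_filter.1 hi).2)
    have := Finset.card_le_card this
    rw [Fin.card_Iio] at this
    exact absurd h (not_lt.2 this)
  · intro h
    have : Finset.Iic j ⊆ (Finset.univ.filter fun i => t i ≤ r) := by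
      intro i hi
      exact Finset.mem_filter.2 ⟨Finset.mem_univ _, (ht.monotone (Finset.mem_Iic.1 hi)).trans h⟩
    have := Finset.card_le_card this
    rw [Fin.card_Iic] at this
    exact this

theorem crossed_apply (ht : StrictMono t) (j : Fin N) : crossed t (t j) = j.succ := by
  ext
  simp only [crossed, ht.le_iff_le, Fin.val_succ]
  rw [← Fin.card_Iic]
  congr 1
  ext
  simp

theorem crossedLeft_apply (ht : StrictMono t) (j : Fin N) : crossedLeft t (t j) = j.castSucc := by
  ext
  simp only [crossedLeft, ht.lt_iff_lt, Fin.val_castSucc]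
  rw [← Fin.card_Iio]
  congr 1
  ext
  simp

theorem crossed_eq_zero {r : ℝ} (h : ∀ j, r < t j) : crossed t r = 0 := by
  ext
  simp [crossed, h]

theorem crossedLeft_eq_last {r : ℝ} (h : ∀ j, t j < r) : crossedLeft t r = Fin.last N := by
  ext
  simp [crossedLeft, h]

theorem crossedLeft_eq_crossed {r : ℝ} (h : ∀ j, t j ≠ r) : crossedLeft t r = crossed t r := by
  ext
  simp only [crossed, crossedLeft]
  congr 2
  ext j
  exact ⟨le_of_lt, fun h' => lt_of_le_of_ne h' (h j)⟩

end Steps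

section StepPath

variable {V : Type*} {θ N : ℕ} {β : ℝ}

/-- The configuration that runs through the values `s 0, …, s N` and jumps at the times `t j`. -/
def stepPath (hβ : 0 < β) (t : Fin N → ℝ) (s : Fin (N + 1) → V → Fin θ) : SpinConfig V θ β where
  val x r := s (crossed t (toIcoMod hβ 0 r)) x
  periodic x r := by simp only [toIcoMod_add_right]
  right_cont x r := by
    filter_upwards [eventually_toIcoMod_right t hβ r] with q hq
    rw [hq]
  left_lim x r := by
    -- The left limit at a multiple of `β` looks at the end of the period, so the representative is
    -- taken in `(0, β]`.
    refine ⟨s (crossedLeft t (toIocMod hβ 0 r)) x, ?_⟩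
    filter_upwards [eventually_toIcoMod_left t hβ r] with q hq
    rw [hq]

variable {t : Fin N → ℝ}

theorem stepPath_leftConf_eq (hβ : 0 < β) (s : Fin (N + 1) → V → Fin θ) (r : ℝ) :
    (stepPath hβ t s).leftConf r = s (crossedLeft t (toIocMod hβ 0 r)) := by
  ext1 x
  refine SpinConfig.leftConf_eq ?_
  filter_upwards [eventually_toIcoMod_left t hβ r] with q hq
  simp only [stepPath, hq]

theorem stepPath_conf (hβ : 0 < β) (ht : StrictMono t) (hI : ∀ j, t j ∈ Set.Ioo 0 β)
    (s : Fin (N + 1) → V → Fin θ) (j : Fin N) : (stepPath hβ t s).conf (t j) = s j.succ := by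
  ext1 x
  simp only [stepPath, SpinConfig.conf]
  rw [(toIcoMod_eq_self hβ).2 ⟨(hI j).1.le, by simpa using (hI j).2⟩, crossed_apply ht]

theorem stepPath_conf_zero (hβ : 0 < β) (hI : ∀ j, t j ∈ Set.Ioo 0 β)
    (s : Fin (N + 1) → V → Fin θ) : (stepPath hβ t s).conf 0 = s 0 := by
  ext1 x
  simp only [stepPath, SpinConfig.conf]
  rw [toIcoMod_apply_left, crossed_eq_zero fun j => (hI j).1]

theorem stepPath_leftConf (hβ : 0 < β) (ht : StrictMono t) (hI : ∀ j, t j ∈ Set.Ioo 0 β)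
    (s : Fin (N + 1) → V → Fin θ) (j : Fin N) :
    (stepPath hβ t s).leftConf (t j) = s j.castSucc := by
  rw [stepPath_leftConf_eq,
    (toIocMod_eq_self hβ).2 ⟨(hI j).1, by simpa using (hI j).2.le⟩, crossedLeft_apply ht]

theorem adaptedTo_stepPath (hβ : 0 < β) (hI : ∀ j, t j ∈ Set.Ioo 0 β)
    {s : Fin (N + 1) → V → Fin θ} (hs : s 0 = s (Fin.last N)) :
    AdaptedTo t (stepPath hβ t s) := by
  intro x r hr
  rw [SpinConfig.eventually_nhds_iff, stepPath_leftConf_eq]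
  simp only [stepPath, SpinConfig.conf]
  by_cases h : (0 : ℝ) ≡ r [PMOD β]
  -- At multiples of `β` the path passes from `s (Fin.last N)` to `s 0`; there is no jump because
  -- the two agree.
  · obtain ⟨z, hz⟩ := AddCommGroup.modEq_iff_eq_add_zsmul.1 h
    have h₁ : toIcoMod hβ 0 r = 0 := by
      refine (toIcoMod_eq_iff hβ).2 ⟨⟨le_rfl, by linarith⟩, z, hz⟩
    have h₂ : toIocMod hβ 0 r = β := by
      refine (toIocMod_eq_iff hβ).2 ⟨⟨hβ, by linarith⟩, z - 1, ?_⟩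
      rw [hz, sub_smul, one_smul]
      ring
    rw [h₁, h₂, crossed_eq_zero fun j => (hI j).1, crossedLeft_eq_last fun j => (hI j).2, hs]
  · have h₁ : toIocMod hβ 0 r = toIcoMod hβ 0 r :=
      ((AddCommGroup.not_modEq_iff_toIcoMod_eq_toIocMod hβ).1 h).symm
    rw [h₁, crossedLeft_eq_crossed]
    intro j hj
    obtain ⟨-, z, hz⟩ := (toIcoMod_eq_iff hβ).1 hj.symm
    exact hr j (AddCommGroup.modEq_iff_eq_add_zsmul.2 ⟨z, hz⟩)

/-- The times at which a step path takes a new value. -/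
def stepTimes (t : Fin N → ℝ) : Fin (N + 1) → ℝ := Fin.cons 0 t

theorem not_modEq_of_stepTimes_lt (hβ : 0 < β) (ht : StrictMono t) (hI : ∀ j, t j ∈ Set.Ioo 0 β)
    {c : Fin (N + 1)} {r : ℝ} (hc : stepTimes t c < r) (hr : r ≤ β)
    (hlt : ∀ j, t j ≤ r → j.val < c.val) (j : Fin N) : ¬ t j ≡ r [PMOD β] := by
  intro h
  have h0 : 0 ≤ stepTimes t c := by
    refine Fin.cases ?_ (fun i => ?_) c
    · simp [stepTimes]
    · simpa [stepTimes] using (hI i).1.le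
  rcases hr.eq_or_lt with rfl | hr
  · have h' : t j ≡ 0 [PMOD r] := h.trans AddCommGroup.self_modEq_zero
    exact (hI j).1.ne' (eq_of_modEq_of_mem_Ico hβ ⟨(hI j).1.le, (hI j).2⟩ ⟨le_rfl, hβ⟩ h')
  · have h' := eq_of_modEq_of_mem_Ico hβ ⟨(hI j).1.le, (hI j).2⟩ ⟨h0.trans hc.le, hr⟩ h
    have hj := hlt j h'.le
    revert hc hj
    clear hlt h0
    refine Fin.cases ?_ (fun i => ?_) c
    · intro _ hj
      simp at hj
    · intro hc hj
      have h₂ : stepTimes t i.succ = t i := by simp [stepTimes]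
      rw [h₂] at hc
      have : t j ≤ t i := ht.monotone (Nat.lt_succ_iff.1 (by simpa using hj))
      linarith

/-- The values are sampled at `0` and at each `t j`. Nothing changes between consecutive sampling
times, and the stretch from the last one to `β` closes the cycle by periodicity. -/
theorem exists_stepPath_eq (hβ : 0 < β) (ht : StrictMono t) (hI : ∀ j, t j ∈ Set.Ioo 0 β)
    {σ : SpinConfig V θ β} (hσ : AdaptedTo t σ) :
    ∃ s : Fin (N + 1) → V → Fin θ, s 0 = s (Fin.last N) ∧ stepPath hβ t s = σ := by
  have key : ∀ (c : Fin (N + 1)) (r : ℝ), stepTimes t c ≤ r → r ≤ β →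
      (∀ j, t j ≤ r → j.val < c.val) → ∀ x, σ.val x r = σ.val x (stepTimes t c) := by
    intro c r hc hr hlt x
    refine σ.val_eq_of_le hc fun q hq => hσ x q ?_
    exact not_modEq_of_stepTimes_lt hβ ht hI hq.1 (hq.2.trans hr) fun j hj => hlt j (hj.trans hq.2)
  refine ⟨fun c => σ.conf (stepTimes t c), ?_, SpinConfig.ext_val fun x r => ?_⟩
  · ext1 x
    have h₁ := key (Fin.last N) β ?_ le_rfl (fun j _ => by simp) x
    · have h₂ := σ.periodic x 0
      rw [zero_add] at h₂
      simp only [SpinConfig.conf]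
      rw [← h₁, h₂]
      simp [stepTimes]
    · refine Fin.cases ?_ (fun i => ?_) (Fin.last N)
      · simpa [stepTimes] using hβ.le
      · simpa [stepTimes] using (hI i).2.le
  · rw [← σ.val_toIcoMod hβ x r]
    have h₀ := toIcoMod_mem_Ico' hβ r
    simp only [stepPath, SpinConfig.conf]
    refine (key _ _ ?_ h₀.2.le (fun j hj => (lt_crossed_iff ht).2 hj) x).symm
    have : ∀ c : Fin (N + 1), (∀ j : Fin N, j.val < c.val → t j ≤ toIcoMod hβ 0 r) →
        stepTimes t c ≤ toIcoMod hβ 0 r := by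
      refine fun c => Fin.cases ?_ (fun i => ?_) c
      · intro _
        simpa [stepTimes] using h₀.1
      · intro h
        simpa [stepTimes] using h i (by simp)
    exact this _ fun j hj => (lt_crossed_iff ht).1 hj

theorem stepPath_injective (hβ : 0 < β) (ht : StrictMono t) (hI : ∀ j, t j ∈ Set.Ioo 0 β) :
    Function.Injective (stepPath (V := V) (θ := θ) hβ t) := by
  intro s s' h
  ext1 c
  refine Fin.cases ?_ (fun i => ?_) c
  · rw [← stepPath_conf_zero hβ hI s, h, stepPath_conf_zero hβ hI]
  · rw [← stepPath_conf hβ ht hI s, h, stepPath_conf hβ ht hI]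

/-- Configurations with jumps at the times `t j` are the cyclic sequences of their values. -/
def stepPathEquiv (hβ : 0 < β) (ht : StrictMono t) (hI : ∀ j, t j ∈ Set.Ioo 0 β) :
    {s : Fin (N + 1) → V → Fin θ // s 0 = s (Fin.last N)} ≃
      {σ : SpinConfig V θ β // AdaptedTo t σ} :=
  Equiv.ofBijective (fun s => ⟨stepPath hβ t s.1, adaptedTo_stepPath hβ hI s.2⟩)
    ⟨fun s s' h => Subtype.ext (stepPath_injective hβ ht hI (congrArg Subtype.val h)), fun σ => by
      obtain ⟨s, hs, h⟩ := exists_stepPath_eq hβ ht hI σ.2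
      exact ⟨⟨s, hs⟩, Subtype.ext h⟩⟩

end StepPath

/-! ### Weighted sums over configurations with prescribed jump times -/

/-- Path expansion of a matrix product. The induction peels off the first factor, so the starting
state has to vary. -/
theorem list_prod_ofFn_apply {S R : Type*} [Fintype S] [DecidableEq S] [CommSemiring R] {N : ℕ}
    (W : Fin N → Matrix S S R) (a b : S) :
    (List.ofFn W).prod a b =
      ∑ s : Fin (N + 1) → S, if s 0 = a ∧ s (Fin.last N) = b then
        ∏ j, W j (s j.castSucc) (s j.succ) else 0 := by
  induction N generalizing a with
  | zero =>
    rw [← (Equiv.funUnique (Fin 1) S).symm.sum_comp]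
    simp [Matrix.one_apply, ite_and, Fin.last, Finset.sum_ite_eq']
  | succ N ih =>
    have hR : ∑ c, W 0 a c * (List.ofFn fun j => W j.succ).prod c b =
        ∑ s : Fin (N + 1) → S, if s (Fin.last N) = b then
          W 0 a (s 0) * ∏ j : Fin N, W j.succ (s j.castSucc) (s j.succ) else 0 := by
      simp_rw [ih, Finset.mul_sum]
      rw [Finset.sum_comm]
      refine Finset.sum_congr rfl fun s _ => ?_
      rw [Finset.sum_eq_single (s 0)]
      · simp
      · intro c _ hc
        simp [Ne.symm hc]
      · simp
    rw [List.ofFn_succ, List.prod_cons, Matrix.mul_apply, hR,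
      ← (Fin.consEquiv fun _ : Fin (N + 2) => S).sum_comp,
      Fintype.sum_prod_type]
    symm
    rw [Finset.sum_eq_single a]
    · refine Finset.sum_congr rfl fun s _ => ?_
      simp only [Fin.consEquiv_apply, Fin.cons_zero, ← Fin.succ_last, Fin.cons_succ,
        Fin.prod_univ_succ, Fin.castSucc_zero, ← Fin.succ_castSucc, true_and]
    · intro c _ hc
      simp [hc]
    · simp

/-- The sum over the configurations with jumps at the times `t j` of the product of the weights
`W j (σ_{t j -}, σ_{t j})`. -/
def pathSum {V J : Type*} {θ : ℕ} [Fintype J] (β : ℝ) (t : J → ℝ)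
    (W : J → Matrix (V → Fin θ) (V → Fin θ) ℝ≥0∞) : ℝ≥0∞ :=
  ∑' σ : {σ : SpinConfig V θ β // AdaptedTo t σ},
    ∏ j, W j (σ.1.leftConf (t j)) (σ.1.conf (t j))

section PathSum

variable {V J : Type*} {θ : ℕ} {β : ℝ} [Fintype J]

/-- Periodicity in time makes the sequence of values a closed walk, and a sum over closed walks is a
trace. -/
theorem pathSum_of_strictMono [Fintype V] [DecidableEq V] {N : ℕ} (hβ : 0 < β) {t : Fin N → ℝ}
    (ht : StrictMono t) (hI : ∀ j, t j ∈ Set.Ioo 0 β)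
    (W : Fin N → Matrix (V → Fin θ) (V → Fin θ) ℝ≥0∞) :
    pathSum β t W = (List.ofFn W).prod.trace := by
  have h : ∀ s, ∏ j, W j ((stepPathEquiv (θ := θ) (V := V) hβ ht hI s).1.leftConf (t j))
      ((stepPathEquiv hβ ht hI s).1.conf (t j)) = ∏ j, W j (s.1 j.castSucc) (s.1 j.succ) :=
    fun s => Finset.prod_congr rfl fun j _ => by
      rw [← stepPath_conf hβ ht hI s.1 j, ← stepPath_leftConf hβ ht hI s.1 j]
      rfl
  rw [pathSum, ← (stepPathEquiv hβ ht hI).tsum_eq, tsum_fintype]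
  simp only [h, Matrix.trace, Matrix.diag, list_prod_ofFn_apply]
  rw [Finset.sum_comm]
  refine (Finset.sum_subtype (Finset.univ.filter fun s : Fin (N + 1) → V → Fin θ =>
    s 0 = s (Fin.last N)) (by simp) fun s => ∏ j, W j (s j.castSucc) (s j.succ)).symm.trans ?_
  rw [Finset.sum_filter]
  refine Finset.sum_congr rfl fun s _ => ?_
  rw [Finset.sum_eq_single (s 0)]
  · simp [eq_comm]
  · intro c _ hc
    simp [Ne.symm hc]
  · simp

theorem pathSum_reindex {J' : Type*} [Fintype J'] (e : J' ≃ J) (t : J → ℝ)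
    (W : J → Matrix (V → Fin θ) (V → Fin θ) ℝ≥0∞) :
    pathSum β (t ∘ e) (W ∘ e) = pathSum β t W := by
  have h : ∀ σ : SpinConfig V θ β, AdaptedTo (t ∘ e) σ ↔ AdaptedTo t σ := by
    intro σ
    simp only [AdaptedTo, Function.comp_apply, e.forall_congr_left, Equiv.apply_symm_apply]
  rw [pathSum, pathSum, ← (Equiv.subtypeEquivRight h).tsum_eq]
  refine tsum_congr fun σ => ?_
  exact e.prod_comp fun j => W j (σ.1.leftConf (t j)) (σ.1.conf (t j))

end PathSum

/-! ### Almost every family of times is injective -/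

/-- Lebesgue measure on the time interval. -/
def timeMeasure (β : ℝ) : Measure ℝ := volume.restrict (Set.Icc 0 β)

instance (β : ℝ) : IsFiniteMeasure (timeMeasure β) := by
  unfold timeMeasure
  infer_instance

theorem timeMeasure_univ (β : ℝ) : timeMeasure β Set.univ = ENNReal.ofReal β := by
  simp [timeMeasure]

/-- The times `t j` are distinct and lie in the open interval `(0, β)`. -/
def GoodTimes {J : Type*} (β : ℝ) (t : J → ℝ) : Prop :=
  Function.Injective t ∧ ∀ j, t j ∈ Set.Ioo 0 β

theorem GoodTimes.comp {J J' : Type*} {β : ℝ} {t : J → ℝ} (h : GoodTimes β t) {e : J' → J}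
    (he : Function.Injective e) : GoodTimes β (t ∘ e) :=
  ⟨h.1.comp he, fun _ => h.2 _⟩

theorem ae_mem_Ioo_timeMeasure (β : ℝ) : ∀ᵐ r ∂timeMeasure β, r ∈ Set.Ioo 0 β := by
  rw [timeMeasure, ← Measure.restrict_congr_set Ioo_ae_eq_Icc]
  exact ae_restrict_mem measurableSet_Ioo

/-- Coincidences lie in the hyperplanes `t i = t j`, proper subspaces and hence Lebesgue null. -/
theorem ae_goodTimes {J : Type*} [Fintype J] (β : ℝ) :
    ∀ᵐ t ∂Measure.pi (fun _ : J => timeMeasure β), GoodTimes β t := by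
  have h₁ : ∀ᵐ t ∂Measure.pi (fun _ : J => timeMeasure β), ∀ j, t j ∈ Set.Ioo 0 β :=
    ae_all_iff.2 fun j => (Measure.tendsto_eval_ae_ae (i := j)).eventually
      (ae_mem_Ioo_timeMeasure β)
  have h₂ : ∀ᵐ t ∂Measure.pi (fun _ : J => timeMeasure β), ∀ i j, i ≠ j → t i ≠ t j := by
    have hac : Measure.pi (fun _ : J => timeMeasure β) ≪ (volume : Measure (J → ℝ)) := by
      simp only [timeMeasure]
      rw [← Measure.restrict_pi_pi]
      exact Measure.absolutelyContinuous_of_le Measure.restrict_le_self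
    refine hac.ae_le ?_
    refine ae_all_iff.2 fun i => ae_all_iff.2 fun j => ?_
    by_cases hij : i = j
    · simp [hij]
    · let p : Submodule ℝ (J → ℝ) :=
        LinearMap.ker ((LinearMap.proj i : (J → ℝ) →ₗ[ℝ] ℝ) - LinearMap.proj j)
      have hp : p ≠ ⊤ := by
        classical
        intro h
        have : Pi.single i (1 : ℝ) ∈ p := h ▸ Submodule.mem_top
        simp [p, hij] at this
      have h0 := Measure.addHaar_submodule volume p hp
      refine (measure_eq_zero_iff_ae_notMem.1 h0).mono fun t ht _ hteq => ht ?_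
      simp [p, hteq]
  filter_upwards [h₁, h₂] with t ht₁ ht₂
  exact ⟨fun i j hij => by_contra fun h => ht₂ i j h hij, ht₁⟩

/-! ### Path sums for almost every family of times -/

section PathSum

variable {V J : Type*} {θ : ℕ} {β : ℝ} [Fintype J]

/-- An enumeration of the indices for which the times are increasing. -/
def sortEquiv (t : J → ℝ) : Fin (Fintype.card J) ≃ J :=
  (Tuple.sort (t ∘ (Fintype.equivFin J).symm)).trans (Fintype.equivFin J).symm

theorem GoodTimes.strictMono_sortEquiv {t : J → ℝ} (h : GoodTimes β t) :
    StrictMono (t ∘ sortEquiv t) :=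
  (Tuple.monotone_sort (t ∘ (Fintype.equivFin J).symm)).strictMono_of_injective
    (h.1.comp (sortEquiv t).injective)

theorem pathSum_eq_trace [Fintype V] [DecidableEq V] (hβ : 0 < β) {t : J → ℝ}
    (h : GoodTimes β t) (W : J → Matrix (V → Fin θ) (V → Fin θ) ℝ≥0∞) :
    pathSum β t W = (List.ofFn (W ∘ sortEquiv t)).prod.trace := by
  rw [← pathSum_reindex (sortEquiv t),
    pathSum_of_strictMono hβ h.strictMono_sortEquiv fun _ => h.2 _]

theorem pathSum_const [Fintype V] [DecidableEq V] (hβ : 0 < β) {t : J → ℝ}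
    (h : GoodTimes β t) (K : Matrix (V → Fin θ) (V → Fin θ) ℝ≥0∞) :
    pathSum β t (fun _ => K) = (K ^ Fintype.card J).trace := by
  rw [pathSum_eq_trace hβ h]
  congr 1
  exact (congrArg List.prod (List.ofFn_const _ K)).trans (List.prod_replicate _ _)

/-- For good times the path sum depends on `t` only through the permutation that sorts it, and each
permutation is selected by finitely many inequalities and equalities. -/
theorem aemeasurable_pathSum [Fintype V] [DecidableEq V] (hβ : 0 < β)
    (W : J → Matrix (V → Fin θ) (V → Fin θ) ℝ≥0∞) :
    AEMeasurable (fun t => pathSum β t W) (Measure.pi fun _ : J => timeMeasure β) := by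
  have hs : ∀ π, MeasurableSet {f : Fin (Fintype.card J) → ℝ | Tuple.sort f = π} := by
    intro π
    have : {f : Fin (Fintype.card J) → ℝ | Tuple.sort f = π} =
        {f | (∀ i j, i ≤ j → f (π i) ≤ f (π j)) ∧
          ∀ i j, i < j → f (π i) = f (π j) → π i < π j} := by
      ext f
      exact eq_comm.trans Tuple.eq_sort_iff
    rw [this]
    measurability
  let _ : MeasurableSpace (Equiv.Perm (Fin (Fintype.card J))) := ⊤
  have hsort : Measurable fun f : Fin (Fintype.card J) → ℝ => Tuple.sort f :=
    measurable_to_countable' fun π => hs π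
  have hcomp : Measurable fun t : J → ℝ => t ∘ (Fintype.equivFin J).symm :=
    measurable_pi_lambda _ fun i => measurable_pi_apply _
  have hF : Measurable fun π : Equiv.Perm (Fin (Fintype.card J)) =>
      (List.ofFn (W ∘ (π.trans (Fintype.equivFin J).symm))).prod.trace := measurable_from_top
  refine ⟨_, hF.comp (hsort.comp hcomp), ?_⟩
  filter_upwards [ae_goodTimes β] with t ht
  exact pathSum_eq_trace hβ ht W

theorem finite_adaptedTo [Finite V] (hβ : 0 < β) {t : J → ℝ} (h : GoodTimes β t) :
    Finite {σ : SpinConfig V θ β // AdaptedTo t σ} := by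
  have h' : ∀ σ : SpinConfig V θ β, AdaptedTo (t ∘ sortEquiv t) σ ↔ AdaptedTo t σ := by
    intro σ
    simp only [AdaptedTo, Function.comp_apply, (sortEquiv t).forall_congr_left,
      Equiv.apply_symm_apply]
  exact Finite.of_equiv _ ((stepPathEquiv hβ h.strictMono_sortEquiv fun _ => h.2 _).trans
    (Equiv.subtypeEquivRight h'))

/-- Off the finitely many jump times the path is locally constant, hence continuous for any topology
on the target. -/
theorem AdaptedTo.aemeasurable {σ : SpinConfig V θ β} [Finite V] {t : J → ℝ} (hσ : AdaptedTo t σ)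
    (hI : ∀ j, t j ∈ Set.Ioo 0 β) {E : Type*} [TopologicalSpace E] [MeasurableSpace E]
    [BorelSpace E] (F : (V → Fin θ) → E) :
    AEMeasurable (fun r => F (σ.conf r)) (timeMeasure β) := by
  have hc : ContinuousOn (fun r => F (σ.conf r)) (Set.Ioo 0 β \ Set.range t) := by
    intro r hr
    refine ContinuousAt.continuousWithinAt ?_
    have h : ∀ᶠ s in 𝓝 r, ∀ x, σ.val x s = σ.val x r := by
      refine Filter.eventually_all.2 fun x => hσ x r fun j hj => hr.2 ⟨j, ?_⟩
      exact eq_of_modEq_of_mem_Ico ((hI j).1.trans (hI j).2) ⟨(hI j).1.le, (hI j).2⟩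
        ⟨hr.1.1.le, hr.1.2⟩ hj
    refine tendsto_const_nhds.congr' (h.mono fun s hs => ?_)
    exact congrArg F (funext fun x => (hs x).symm)
  have hm : MeasurableSet (Set.Ioo 0 β \ Set.range t) :=
    measurableSet_Ioo.diff (Set.finite_range t).measurableSet
  have hae : (Set.Ioo 0 β \ Set.range t : Set ℝ) =ᵐ[volume] Set.Icc 0 β :=
    (sdiff_null_ae_eq_self ((Set.finite_range t).measure_zero _)).trans Ioo_ae_eq_Icc
  rw [timeMeasure, ← Measure.restrict_congr_set hae]
  exact hc.aemeasurable hm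

end PathSum

/-! ### Compatible configurations -/

/-- The configurations `s` before and `s'` after the transition of kind `κ` on the edge `e`
satisfy the constraints of the transition. -/
def TransitionAllowed {V : Type*} {θ : ℕ} (e : Sym2 V) (κ : Kind) (s s' : V → Fin θ) : Prop :=
  (∀ z, z ∉ e → s z = s' z) ∧ ∀ x y, e = s(x, y) → (s' x, s' y, s x, s y) ∈ κ.allowed θ

open Classical in
/-- The matrix of a transition. -/
def transitionMatrix {V : Type*} {θ : ℕ} (R : Type*) [Zero R] [One R] (e : Sym2 V) (κ : Kind) :
    Matrix (V → Fin θ) (V → Fin θ) R :=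
  Matrix.of fun s s' => if TransitionAllowed e κ s s' then 1 else 0

section Compatible

variable {V J : Type*} {G : SimpleGraph V} {θ : ℕ} {β : ℝ}

/-- The additional times `r` are those of the diagonal insertions. Recording that `σ` does not jump
there puts transitions and insertions on the same footing: a condition on the pair (left limit,
value) at each time. -/
theorem compatible_iff (hβ : 0 < β) {ξ : Realization G} {r : J → ℝ}
    (hg : GoodTimes β (Sum.elim (fun j => (ξ.2 j).2.1) r)) (σ : SpinConfig V θ β) :
    Compatible ξ σ ↔ AdaptedTo (Sum.elim (fun j => (ξ.2 j).2.1) r) σ ∧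
      (∀ j, TransitionAllowed ((ξ.2 j).1 : Sym2 V) (ξ.2 j).2.2 (σ.leftConf (ξ.2 j).2.1)
        (σ.conf (ξ.2 j).2.1)) ∧ ∀ i, σ.leftConf (r i) = σ.conf (r i) := by
  have hinj : ∀ a b, Sum.elim (fun j => (ξ.2 j).2.1) r a ≡
      Sum.elim (fun j => (ξ.2 j).2.1) r b [PMOD β] → a = b := fun a b h =>
    hg.1 (eq_of_modEq_of_mem_Ico hβ ⟨(hg.2 a).1.le, (hg.2 a).2⟩ ⟨(hg.2 b).1.le, (hg.2 b).2⟩ h)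
  have hloc : ∀ j x y, (∀ᶠ s in 𝓝[<] (ξ.2 j).2.1,
      (σ.val x (ξ.2 j).2.1, σ.val y (ξ.2 j).2.1, σ.val x s, σ.val y s)
        ∈ (ξ.2 j).2.2.allowed θ) ↔
      (σ.conf (ξ.2 j).2.1 x, σ.conf (ξ.2 j).2.1 y, σ.leftConf (ξ.2 j).2.1 x,
        σ.leftConf (ξ.2 j).2.1 y) ∈ (ξ.2 j).2.2.allowed θ := by
    intro j x y
    have h := (σ.eventually_leftConf x (ξ.2 j).2.1).and (σ.eventually_leftConf y (ξ.2 j).2.1)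
    constructor
    · intro h'
      obtain ⟨s, hs, hs'⟩ := (h.and h').exists
      rw [hs.1, hs.2] at hs'
      exact hs'
    · intro h'
      filter_upwards [h] with s hs
      rw [hs.1, hs.2]
      exact h'
  simp only [Compatible, hloc]
  constructor
  · rintro ⟨h₁, h₂⟩
    refine ⟨fun x t ht => h₂ x t fun j _ => ht (Sum.inl j), fun j => ⟨fun z hz => ?_, h₁ j⟩,
      fun i => funext fun x => ?_⟩
    · refine (σ.eventually_nhds_iff z _).1 (h₂ z _ fun j' hj' h => hz ?_)
      have := hinj (Sum.inl j') (Sum.inl j) h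
      rw [← Sum.inl.inj this]
      exact hj'
    · refine (σ.eventually_nhds_iff x _).1 (h₂ x _ fun j' _ h => ?_)
      exact Sum.inl_ne_inr (hinj (Sum.inl j') (Sum.inr i) h)
  · rintro ⟨h₁, h₂, h₃⟩
    refine ⟨fun j => (h₂ j).2, fun x t ht => ?_⟩
    by_cases h : ∀ a, ¬ Sum.elim (fun j => (ξ.2 j).2.1) r a ≡ t [PMOD β]
    · exact h₁ x t h
    · push Not at h
      obtain ⟨a, ha⟩ := h
      refine σ.eventually_nhds_of_modEq ha x ((σ.eventually_nhds_iff x _).2 ?_)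
      rcases a with j | i
      · refine (h₂ j).1 x fun hx => ht j hx ha
      · exact congrFun (h₃ i) x

/-- Adapted configurations that are not compatible contribute nothing: a transition matrix or an
off-diagonal entry of `Matrix.diagonal H` vanishes on them. -/
theorem tsum_compatible_prod (hβ : 0 < β) [Fintype V] [DecidableEq V] [Fintype J]
    {ξ : Realization G} {r : J → ℝ}
    (hg : GoodTimes β (Sum.elim (fun j => (ξ.2 j).2.1) r)) (H : (V → Fin θ) → ℝ≥0∞) :
    ∑' σ : {σ : SpinConfig V θ β // Compatible ξ σ}, ∏ i, H (σ.1.conf (r i)) =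
      pathSum β (Sum.elim (fun j => (ξ.2 j).2.1) r)
        (Sum.elim (fun j => transitionMatrix ℝ≥0∞ ((ξ.2 j).1 : Sym2 V) (ξ.2 j).2.2)
          fun _ => Matrix.diagonal H) := by
  have hc := fun σ => compatible_iff (θ := θ) hβ hg σ
  have hle : ∀ σ : {σ : SpinConfig V θ β // Compatible ξ σ},
      AdaptedTo (Sum.elim (fun j => (ξ.2 j).2.1) r) σ.1 := fun σ => ((hc σ.1).1 σ.2).1
  rw [pathSum]
  refine Eq.trans (tsum_congr fun σ => ?_) (Function.Injective.tsum_eq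
    (g := fun σ : {σ : SpinConfig V θ β // Compatible ξ σ} =>
      (⟨σ.1, hle σ⟩ : {σ : SpinConfig V θ β // AdaptedTo (Sum.elim (fun j => (ξ.2 j).2.1) r) σ}))
    (fun σ σ' h => Subtype.ext (congrArg (fun σ => σ.1) h)) ?_)
  · obtain ⟨-, h₁, h₂⟩ := (hc σ.1).1 σ.2
    simp [Fintype.prod_sum_type, transitionMatrix, h₁, h₂]
  · intro σ hσ
    rw [Function.mem_support, Finset.prod_ne_zero_iff] at hσ
    refine ⟨⟨σ.1, (hc σ.1).2 ⟨σ.2, fun j => ?_, fun i => ?_⟩⟩, rfl⟩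
    · have := hσ (Sum.inl j) (Finset.mem_univ _)
      by_contra h
      simp [transitionMatrix, h] at this
    · have := hσ (Sum.inr i) (Finset.mem_univ _)
      by_contra h
      simp [h] at this

theorem finite_compatible (hβ : 0 < β) [Finite V] {ξ : Realization G}
    (hg : GoodTimes β fun j => (ξ.2 j).2.1) :
    Finite {σ : SpinConfig V θ β // Compatible ξ σ} := by
  have := finite_adaptedTo (V := V) (θ := θ) hβ hg
  have hle : ∀ σ : {σ : SpinConfig V θ β // Compatible ξ σ},
      AdaptedTo (fun j => (ξ.2 j).2.1) σ.1 := fun σ x t ht => σ.2.2 x t fun j _ => ht j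
  exact Finite.of_injective (fun σ => (⟨σ.1, hle σ⟩ :
    {σ : SpinConfig V θ β // AdaptedTo (fun j => (ξ.2 j).2.1) σ}))
    fun σ σ' h => Subtype.ext (congrArg (fun σ => σ.1) h)

end Compatible

/-! ### Integration against the Poisson process -/

instance : Fintype Kind :=
  Fintype.ofEquiv Bool
    { toFun := fun b => if b then Kind.cross else Kind.doubleBar
      invFun := fun κ => match κ with
        | .cross => true
        | .doubleBar => false
      left_inv := fun b => by cases b <;> rfl
      right_inv := fun κ => by cases κ <;> rfl }

theorem sum_kind {M : Type*} [AddCommMonoid M] (g : Kind → M) :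
    ∑ κ, g κ = g .cross + g .doubleBar := by
  classical
  have : (Finset.univ : Finset Kind) = {Kind.cross, Kind.doubleBar} := by
    ext κ
    cases κ <;> simp
  rw [this, Finset.sum_pair (by simp)]

/-- The intensity of the transitions of a given kind. -/
def kindWeight (u : ℝ) : Kind → ℝ
  | .cross => u
  | .doubleBar => 1 - u

theorem lintegral_kindMeasure (u : ℝ) (g : Kind → ℝ≥0∞) :
    ∫⁻ κ, g κ ∂kindMeasure u = ∑ κ, ENNReal.ofReal (kindWeight u κ) * g κ := by
  have hg : Measurable g := measurable_from_top
  rw [kindMeasure, lintegral_add_measure, lintegral_smul_measure, lintegral_smul_measure,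
    lintegral_dirac' _ hg, lintegral_dirac' _ hg, sum_kind]
  rfl

instance (u : ℝ) : IsFiniteMeasure (kindMeasure u) := by
  constructor
  rw [← lintegral_one, lintegral_kindMeasure, sum_kind]
  simp

instance {V : Type*} (G : SimpleGraph V) : DiscreteMeasurableSpace G.edgeSet := ⟨fun _ => trivial⟩

instance {V : Type*} (G : SimpleGraph V) [Finite G.edgeSet] :
    IsFiniteMeasure (Measure.count : Measure G.edgeSet) :=
  ⟨Measure.count_apply_lt_top.2 Set.finite_univ⟩

section Intensity

variable {V : Type*} {G : SimpleGraph V} [Fintype G.edgeSet] {β u : ℝ}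

instance : IsFiniteMeasure (intensity G β u) := by
  have : IsFiniteMeasure (volume.restrict (Set.Icc 0 β)) := inferInstance
  unfold intensity
  infer_instance

theorem intensity_apply {s : Set (Transition G)} (hs : MeasurableSet s) :
    intensity G β u s = ∑ l : G.edgeSet × Kind,
      ENNReal.ofReal (kindWeight u l.2) * timeMeasure β {t | (l.1, t, l.2) ∈ s} := by
  rw [intensity, Measure.prod_apply hs, lintegral_count, tsum_fintype, Fintype.sum_prod_type]
  refine Finset.sum_congr rfl fun e _ => ?_
  rw [Measure.prod_apply_symm (measurable_prodMk_left hs), lintegral_kindMeasure]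
  rfl

theorem intensity_univ : intensity G β u Set.univ =
    Fintype.card G.edgeSet * ((ENNReal.ofReal u + ENNReal.ofReal (1 - u)) * ENNReal.ofReal β) := by
  rw [intensity_apply MeasurableSet.univ, Fintype.sum_prod_type]
  simp [sum_kind, kindWeight, ← add_mul, timeMeasure]

/-- The realization with labels `l` and times `t`. -/
def labelled {n : ℕ} (l : Fin n → G.edgeSet × Kind) (t : Fin n → ℝ) : Fin n → Transition G :=
  fun j => ((l j).1, t j, (l j).2)

omit [Fintype G.edgeSet] in
-- For an embedding the change of variables holds for every integrand, so no measurability of the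
-- sum over compatible configurations is required.
theorem measurableEmbedding_labelled {n : ℕ} (l : Fin n → G.edgeSet × Kind) :
    MeasurableEmbedding (labelled l) := by
  have hm : Measurable (labelled l) := by
    unfold labelled
    fun_prop
  refine MeasurableEmbedding.of_measurable_inverse (g := fun ξ j => (ξ j).2.1) hm ?_
    (by fun_prop) fun t => rfl
  have : Set.range (labelled l) = {ξ | ∀ j, (ξ j).1 = (l j).1 ∧ (ξ j).2.2 = (l j).2} := by
    ext ξ
    constructor
    · rintro ⟨t, rfl⟩ j
      exact ⟨rfl, rfl⟩
    · intro h
      exact ⟨fun j => (ξ j).2.1, funext fun j => Prod.ext (h j).1.symm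
        (Prod.ext rfl (h j).2.symm)⟩
  rw [this]
  have h₁ : ∀ j, Measurable fun ξ : Fin n → Transition G => (ξ j).1 := fun j => by fun_prop
  have h₂ : ∀ j, Measurable fun ξ : Fin n → Transition G => (ξ j).2.2 := fun j => by fun_prop
  have : {ξ : Fin n → Transition G | ∀ j, (ξ j).1 = (l j).1 ∧ (ξ j).2.2 = (l j).2} =
      ⋂ j, ((fun ξ => (ξ j).1) ⁻¹' {(l j).1} ∩ (fun ξ => (ξ j).2.2) ⁻¹' {(l j).2}) := by
    ext ξ
    simp
  rw [this]
  exact MeasurableSet.iInter fun j => (h₁ j trivial).inter (h₂ j trivial)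

/-- Edge and kind are discrete, so the law of `n` points is a finite weighted sum over labels of
Lebesgue measure in the times. -/
theorem pi_intensity (n : ℕ) : Measure.pi (fun _ : Fin n => intensity G β u) =
    ∑ l : Fin n → G.edgeSet × Kind, (∏ j, ENNReal.ofReal (kindWeight u (l j).2)) •
      (Measure.pi fun _ : Fin n => timeMeasure β).map (labelled l) := by
  classical
  refine Measure.pi_eq fun s hs => ?_
  simp only [intensity_apply (hs _)]
  rw [Finset.prod_univ_sum, Measure.finsetSum_apply, Fintype.piFinset_univ]
  refine Finset.sum_congr rfl fun l _ => ?_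
  rw [Measure.smul_apply, (measurableEmbedding_labelled l).map_apply, Finset.prod_mul_distrib,
    smul_eq_mul, ← Measure.pi_pi]
  congr 2

theorem lintegral_pi_intensity {n : ℕ} (F : (Fin n → Transition G) → ℝ≥0∞) :
    ∫⁻ ξ, F ξ ∂Measure.pi (fun _ : Fin n => intensity G β u) =
      ∑ l : Fin n → G.edgeSet × Kind, (∏ j, ENNReal.ofReal (kindWeight u (l j).2)) *
        ∫⁻ t, F (labelled l t) ∂Measure.pi fun _ : Fin n => timeMeasure β := by
  rw [pi_intensity, lintegral_finsetSum_measure]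
  refine Finset.sum_congr rfl fun l _ => ?_
  rw [lintegral_smul_measure, (measurableEmbedding_labelled l).lintegral_map, smul_eq_mul]

end Intensity

theorem measurableEmbedding_sigmaMk {ι : Type*} {X : ι → Type*} [∀ i, MeasurableSpace (X i)]
    (i : ι) : MeasurableEmbedding (Sigma.mk i : X i → Σ i, X i) := by
  have hm : ∀ j, Measurable (Sigma.mk j : X j → Σ i, X i) := fun j =>
    measurable_iff_le_map.2 (iInf_le _ j)
  refine ⟨sigma_mk_injective, hm i, fun {s} hs => ?_⟩
  refine MeasurableSpace.measurableSet_iInf.2 fun j => ?_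
  change MeasurableSet (Sigma.mk j ⁻¹' (Sigma.mk i '' s))
  by_cases h : i = j
  · subst h
    rwa [Set.preimage_image_eq _ sigma_mk_injective]
  · convert MeasurableSet.empty
    ext x
    simp [h]

theorem lintegral_poissonProcess {X : Type*} [MeasurableSpace X] (m : Measure X)
    (F : (Σ n : ℕ, (Fin n → X)) → ℝ≥0∞) :
    ∫⁻ ξ, F ξ ∂(poissonProcess m) = ∑' n : ℕ,
      ENNReal.ofReal (Real.exp (-(m Set.univ).toReal) / (n ! : ℝ)) *
        ∫⁻ x, F ⟨n, x⟩ ∂Measure.pi fun _ : Fin n => m := by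
  rw [poissonProcess, lintegral_sum_measure]
  refine tsum_congr fun n => ?_
  rw [lintegral_smul_measure, (measurableEmbedding_sigmaMk n).lintegral_map, smul_eq_mul]

theorem lintegral_pi_prod {X : Type*} [MeasurableSpace X] (m : Measure X) [SigmaFinite m]
    {g : X → ℝ≥0∞} (hg : AEMeasurable g m) (k : ℕ) :
    ∫⁻ x, ∏ i, g (x i) ∂Measure.pi (fun _ : Fin k => m) = (∫⁻ x, g x ∂m) ^ k := by
  induction k with
  | zero => simp
  | succ k ih =>
    have hp := (measurePreserving_piFinSuccAbove (fun _ : Fin (k + 1) => m) 0).symm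
    rw [MeasurePreserving.lintegral_map_equiv _ _ hp]
    simp only [Fin.prod_univ_succ]
    have := lintegral_prod_mul (μ := m) (ν := Measure.pi fun _ : Fin k => m) (f := g)
      (g := fun x => ∏ i, g (x i)) hg
      (Finset.aemeasurable_fun_prod _ fun i _ => hg.comp_quasiMeasurePreserving
        (Measure.quasiMeasurePreserving_eval _ i))
    rw [pow_succ', ← ih, ← this]
    rfl

/-! ### Superposition of two families of times -/

section Superposition

variable {V : Type*} {θ : ℕ} {β : ℝ}

theorem sum_powerset_pathSum {J : Type*} [Fintype J] [DecidableEq J] (t : J → ℝ)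
    (A B : Matrix (V → Fin θ) (V → Fin θ) ℝ≥0∞) :
    ∑ S ∈ (Finset.univ : Finset J).powerset, pathSum β t (fun j => if j ∈ S then A else B) =
      pathSum β t fun _ => A + B := by
  simp only [pathSum]
  rw [← Summable.tsum_finsetSum fun _ _ => ENNReal.summable]
  refine tsum_congr fun σ => ?_
  simp only [Matrix.add_apply]
  rw [Finset.prod_add]
  refine Finset.sum_congr rfl fun S _ => ?_
  have h := Finset.prod_piecewise Finset.univ S
    (fun j => A (σ.1.leftConf (t j)) (σ.1.conf (t j)))
    fun j => B (σ.1.leftConf (t j)) (σ.1.conf (t j))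
  rw [Finset.univ_inter] at h
  rw [← h]
  refine Finset.prod_congr rfl fun j _ => ?_
  by_cases h : j ∈ S <;> simp [h, Finset.piecewise]

/-- Distributivity for a fixed path: summing over independent labels replaces each transition by the
total weighted matrix. -/
theorem sum_labels_pathSum {J J' ι : Type*} [Fintype J] [DecidableEq J] [Fintype J'] [Fintype ι]
    (t : J ⊕ J' → ℝ) (w : ι → ℝ≥0∞) (A : ι → Matrix (V → Fin θ) (V → Fin θ) ℝ≥0∞)
    (B : J' → Matrix (V → Fin θ) (V → Fin θ) ℝ≥0∞) :
    ∑ l : J → ι, (∏ j, w (l j)) * pathSum β t (Sum.elim (fun j => A (l j)) B) =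
      pathSum β t (Sum.elim (fun _ => ∑ i, w i • A i) B) := by
  simp only [pathSum, ← ENNReal.tsum_mul_left]
  rw [← Summable.tsum_finsetSum fun _ _ => ENNReal.summable]
  refine tsum_congr fun σ => ?_
  simp only [Fintype.prod_sum_type, Sum.elim_inl, Sum.elim_inr, Matrix.sum_apply,
    Matrix.smul_apply, smul_eq_mul]
  rw [Finset.prod_univ_sum, Fintype.piFinset_univ, Finset.sum_mul]
  refine Finset.sum_congr rfl fun l _ => ?_
  rw [Finset.prod_mul_distrib, mul_assoc]

variable [Fintype V] [DecidableEq V]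

/-- The integral of the path sum over all families of times. -/
def pathIntegral {J : Type*} [Fintype J] (β : ℝ)
    (W : J → Matrix (V → Fin θ) (V → Fin θ) ℝ≥0∞) : ℝ≥0∞ :=
  ∫⁻ t, pathSum β t W ∂Measure.pi fun _ : J => timeMeasure β

omit [Fintype V] [DecidableEq V] in
theorem pathIntegral_reindex {J J' : Type*} [Fintype J] [Fintype J'] (e : J' ≃ J)
    (W : J → Matrix (V → Fin θ) (V → Fin θ) ℝ≥0∞) :
    pathIntegral β (W ∘ e) = pathIntegral β W := by
  have hp := measurePreserving_piCongrLeft (fun _ : J => timeMeasure β) e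
  rw [pathIntegral, pathIntegral, MeasurePreserving.lintegral_map_equiv _ _ hp]
  refine lintegral_congr fun t => ?_
  rw [← pathSum_reindex e]
  congr 1
  ext j
  exact (Equiv.piCongrLeft_apply_apply (fun _ : J => ℝ) e t j).symm

theorem pathIntegral_sum (hβ : 0 < β) {J J' : Type*} [Fintype J] [Fintype J']
    (W : J ⊕ J' → Matrix (V → Fin θ) (V → Fin θ) ℝ≥0∞) :
    pathIntegral β W = ∫⁻ t, ∫⁻ r, pathSum β (Sum.elim t r) W
      ∂(Measure.pi fun _ : J' => timeMeasure β) ∂Measure.pi fun _ : J => timeMeasure β := by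
  have hp := (measurePreserving_sumPiEquivProdPi (fun _ : J ⊕ J' => timeMeasure β)).symm
  have hm := (aemeasurable_pathSum hβ W).comp_quasiMeasurePreserving hp.quasiMeasurePreserving
  rw [pathIntegral, MeasurePreserving.lintegral_map_equiv _ _ hp]
  refine (lintegral_prod _ hm).trans (lintegral_congr fun t => lintegral_congr fun r => ?_)
  simp only [Function.comp_apply]
  rfl

theorem pathIntegral_const (hβ : 0 < β) {J : Type*} [Fintype J]
    (K : Matrix (V → Fin θ) (V → Fin θ) ℝ≥0∞) :
    pathIntegral β (fun _ : J => K) =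
      ENNReal.ofReal β ^ Fintype.card J * (K ^ Fintype.card J).trace := by
  rw [pathIntegral, lintegral_congr_ae (g := fun _ => (K ^ Fintype.card J).trace)]
  · rw [lintegral_const, mul_comm, ← Set.pi_univ, Measure.pi_pi]
    simp [timeMeasure_univ]
  · filter_upwards [ae_goodTimes β] with t ht
    exact pathSum_const hβ ht K

/-- Expand `A + B` at each of the `N` times according to the set `S` of times that carry `A`; the
integral depends only on the cardinality of `S`. -/
theorem sum_choose_pathIntegral (hβ : 0 < β) (A B : Matrix (V → Fin θ) (V → Fin θ) ℝ≥0∞) (N : ℕ) :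
    ∑ n ∈ Finset.range (N + 1), N.choose n • pathIntegral β
        (Sum.elim (fun _ : Fin n => A) fun _ : Fin (N - n) => B) =
      ENNReal.ofReal β ^ N * ((A + B) ^ N).trace := by
  have h := pathIntegral_const (J := Fin N) hβ (A + B)
  rw [Fintype.card_fin] at h
  rw [← h]
  have hcard := Finset.sum_powerset_apply_card (x := (Finset.univ : Finset (Fin N)))
    fun n => pathIntegral β (Sum.elim (fun _ : Fin n => A) fun _ : Fin (N - n) => B)
  rw [Finset.card_univ, Fintype.card_fin] at hcard
  rw [← hcard]
  rw [pathIntegral]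
  simp only [← sum_powerset_pathSum]
  rw [lintegral_finsetSum' _ fun S _ => aemeasurable_pathSum hβ _]
  refine Finset.sum_congr rfl fun S _ => ?_
  have hS : Sᶜ.card = N - S.card := by rw [Finset.card_compl, Fintype.card_fin]
  change _ = pathIntegral β _
  rw [← pathIntegral_reindex (finSumEquivOfFinset rfl hS)]
  congr 1
  ext1 j
  rcases j with j | j
  · simp
  · have : Sᶜ.orderEmbOfFin hS j ∉ S := Finset.mem_compl.1 (Finset.orderEmbOfFin_mem _ _ _)
    simp [this]

/-- Superposition of two Poisson families: group by `N = n + k` and use `1 / (n! k!) = N.choose n /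
N!`. -/
theorem tsum_tsum_pathIntegral (hβ : 0 < β) (A B : Matrix (V → Fin θ) (V → Fin θ) ℝ≥0∞) :
    ∑' n : ℕ, (n ! : ℝ≥0∞)⁻¹ * ∑' k : ℕ, (k ! : ℝ≥0∞)⁻¹ *
        pathIntegral β (Sum.elim (fun _ : Fin n => A) fun _ : Fin k => B) =
      ∑' N : ℕ, (N ! : ℝ≥0∞)⁻¹ * (ENNReal.ofReal β ^ N * ((A + B) ^ N).trace) := by
  simp only [← ENNReal.tsum_mul_left]
  rw [← ENNReal.tsum_prod, ← Finset.HasAntidiagonal.sigmaAntidiagonalEquivProd.tsum_eq,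
    ENNReal.tsum_sigma']
  refine tsum_congr fun N => ?_
  rw [tsum_fintype, ← sum_choose_pathIntegral hβ, Finset.mul_sum]
  refine Eq.trans (Finset.sum_coe_sort (Finset.HasAntidiagonal.antidiagonal N)
    fun p : ℕ × ℕ => (p.1 ! : ℝ≥0∞)⁻¹ *
      ((p.2 ! : ℝ≥0∞)⁻¹ * pathIntegral β (Sum.elim (fun _ : Fin p.1 => A) fun _ : Fin p.2 => B))) ?_
  rw [Finset.Nat.sum_antidiagonal_eq_sum_range_succ fun n k => (n ! : ℝ≥0∞)⁻¹ *
      ((k ! : ℝ≥0∞)⁻¹ * pathIntegral β (Sum.elim (fun _ : Fin n => A) fun _ : Fin k => B))]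
  refine Finset.sum_congr rfl fun n hn => ?_
  have hle : n ≤ N := Nat.lt_succ_iff.1 (Finset.mem_range.1 hn)
  have h0 : ∀ m : ℕ, (m ! : ℝ≥0∞) ≠ 0 := fun m => by exact_mod_cast Nat.factorial_ne_zero m
  have ht : ∀ m : ℕ, (m ! : ℝ≥0∞) ≠ ∞ := fun m => ENNReal.natCast_ne_top _
  rw [nsmul_eq_mul, ← mul_assoc, ← mul_assoc]
  congr 1
  rw [← Nat.choose_mul_factorial_mul_factorial hle]
  push_cast
  have hc0 : (N.choose n : ℝ≥0∞) ≠ 0 := by exact_mod_cast (Nat.choose_pos hle).ne'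
  rw [ENNReal.mul_inv (Or.inr (ht _)) (Or.inr (h0 _)), ENNReal.mul_inv (Or.inr (ht _))
    (Or.inr (h0 _))]
  calc (n ! : ℝ≥0∞)⁻¹ * ((N - n)! : ℝ≥0∞)⁻¹
      = ((N.choose n : ℝ≥0∞)⁻¹ * (N.choose n : ℝ≥0∞)) *
          ((n ! : ℝ≥0∞)⁻¹ * ((N - n)! : ℝ≥0∞)⁻¹) := by
        rw [ENNReal.inv_mul_cancel hc0 (ENNReal.natCast_ne_top _), one_mul]
    _ = _ := by ring

end Superposition

/-! ### Traces of exponentials -/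

section Exponential

attribute [local instance] Matrix.linftyOpNormedRing Matrix.linftyOpNormedAlgebra

variable {S : Type*} [Fintype S] [DecidableEq S]

theorem hasSum_trace_exp (X : Matrix S S ℝ) :
    HasSum (fun N : ℕ => (N ! : ℝ)⁻¹ * (X ^ N).trace) (NormedSpace.exp X).trace := by
  have h := NormedSpace.exp_series_hasSum_exp' (𝕂 := ℝ) X
  have h' := h.mapL (LinearMap.toContinuousLinearMap (Matrix.traceLinearMap S ℝ ℝ))
  simp at h'
  exact h'

theorem exp_add_smul_one (X : Matrix S S ℝ) (a : ℝ) :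
    NormedSpace.exp (X + a • (1 : Matrix S S ℝ)) = Real.exp a • NormedSpace.exp X := by
  rw [Matrix.exp_add_of_commute _ _ ((Commute.one_right X).smul_right a)]
  have : NormedSpace.exp (a • (1 : Matrix S S ℝ)) = Real.exp a • 1 := by
    rw [← Matrix.diagonal_one, ← Matrix.diagonal_smul, Matrix.exp_diagonal, ← Matrix.diagonal_smul]
    congr 1
    ext i
    rw [Pi.coe_exp]
    simp [Real.exp_eq_exp_ℝ]
  rw [this]
  simp

/-- `ENNReal.ofReal` is not a ring homomorphism on `ℝ`, but on nonnegative entries it factors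
through `NNReal`, from which both inclusions are. -/
theorem trace_pow_map_ofReal {X : Matrix S S ℝ} (hX : ∀ i j, 0 ≤ X i j) (N : ℕ) :
    ((X.map ENNReal.ofReal) ^ N).trace = ENNReal.ofReal (X ^ N).trace := by
  set Y : Matrix S S NNReal := X.map Real.toNNReal
  have h₁ : X.map ENNReal.ofReal = ENNReal.ofNNRealHom.mapMatrix Y := rfl
  have h₂ : X = NNReal.toRealHom.mapMatrix Y := by
    ext i j
    exact (Real.coe_toNNReal _ (hX i j)).symm
  have h₃ : (X ^ N).trace = ((Y ^ N).trace : NNReal) := by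
    conv_lhs => rw [h₂, ← map_pow]
    simp [Matrix.trace]
  rw [h₃, ENNReal.ofReal_coe_nnreal, h₁, ← map_pow]
  exact (map_sum ENNReal.ofNNRealHom (fun i => (Y ^ N) i i) Finset.univ).symm

theorem trace_pow_nonneg {X : Matrix S S ℝ} (hX : ∀ i j, 0 ≤ X i j) (N : ℕ) :
    0 ≤ (X ^ N).trace := by
  have hpow : ∀ N i j, 0 ≤ (X ^ N) i j := by
    intro N
    induction N with
    | zero =>
      intro i j
      rw [pow_zero, Matrix.one_apply]
      split_ifs <;> simp
    | succ N ih =>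
      intro i j
      rw [pow_succ, Matrix.mul_apply]
      exact Finset.sum_nonneg fun k _ => mul_nonneg (ih i k) (hX k j)
  exact Finset.sum_nonneg fun i _ => hpow N i i

theorem trace_exp_nonneg {X : Matrix S S ℝ} (hX : ∀ i j, 0 ≤ X i j) :
    0 ≤ (NormedSpace.exp X).trace :=
  (hasSum_trace_exp X).nonneg fun N => mul_nonneg (by positivity) (trace_pow_nonneg hX N)

theorem tsum_trace_pow_map_ofReal {X : Matrix S S ℝ} (hX : ∀ i j, 0 ≤ X i j) {β : ℝ}
    (hβ : 0 ≤ β) :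
    ∑' N : ℕ, (N ! : ℝ≥0∞)⁻¹ * (ENNReal.ofReal β ^ N * ((X.map ENNReal.ofReal) ^ N).trace) =
      ENNReal.ofReal (NormedSpace.exp (β • X)).trace := by
  have hs := hasSum_trace_exp (β • X)
  rw [← hs.tsum_eq, ENNReal.ofReal_tsum_of_nonneg _ hs.summable]
  · refine tsum_congr fun N => ?_
    rw [trace_pow_map_ofReal hX, smul_pow, Matrix.trace_smul, smul_eq_mul,
      ENNReal.ofReal_mul (by positivity), ENNReal.ofReal_mul (by positivity),
      ENNReal.ofReal_inv_of_pos (by positivity), ENNReal.ofReal_natCast, ENNReal.ofReal_pow hβ]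
  · intro N
    rw [smul_pow, Matrix.trace_smul, smul_eq_mul]
    have := trace_pow_nonneg hX N
    positivity

end Exponential

theorem ofReal_exp_eq_tsum {x : ℝ} (hx : 0 ≤ x) :
    ENNReal.ofReal (Real.exp x) = ∑' k : ℕ, (k ! : ℝ≥0∞)⁻¹ * ENNReal.ofReal x ^ k := by
  have hs : HasSum (fun k : ℕ => x ^ k / (k ! : ℝ)) (Real.exp x) := by
    rw [Real.exp_eq_exp_ℝ]
    exact NormedSpace.expSeries_div_hasSum_exp x
  rw [← hs.tsum_eq, ENNReal.ofReal_tsum_of_nonneg (fun k => by positivity) hs.summable]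
  refine tsum_congr fun k => ?_
  rw [div_eq_inv_mul, ENNReal.ofReal_mul (by positivity),
    ENNReal.ofReal_inv_of_pos (by positivity), ENNReal.ofReal_natCast, ENNReal.ofReal_pow hx]

/-! ### The Feynman–Kac formula -/

section FeynmanKac

variable {V : Type*} {G : SimpleGraph V} {θ : ℕ} {β u : ℝ}

/-- The energy of the edge `{x,y}` in a given configuration. -/
def edgePotential (f : Fin θ → ℝ) (v : V → ℝ) (s : V → Fin θ) : Sym2 V → ℝ :=
  Sym2.lift ⟨fun x y => (f (s x) - f (s y)) * (v x - v y) + 1 / 4 * (v x - v y) ^ 2, by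
    intro x y
    ring⟩

variable (G) in
/-- The energy of a configuration. -/
def potential [Fintype G.edgeSet] (f : Fin θ → ℝ) (v : V → ℝ) (s : V → Fin θ) : ℝ :=
  ∑ e : G.edgeSet, edgePotential f v s e

theorem edgeEnergy_eq (hβ : 0 < β) (f : Fin θ → ℝ) (v : V → ℝ) (σ : SpinConfig V θ β)
    (e : Sym2 V) :
    edgeEnergy f v σ e = ∫ r, edgePotential f v (σ.conf r) e ∂timeMeasure β := by
  induction e with
  | h x y =>
    simp only [edgeEnergy, edgePotential, Sym2.lift_mk]
    rw [intervalIntegral.integral_of_le hβ.le, ← integral_Icc_eq_integral_Ioc]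
    rfl

theorem AdaptedTo.integrable [Finite V] {J : Type*} [Fintype J] {σ : SpinConfig V θ β}
    {t : J → ℝ} (hσ : AdaptedTo t σ) (hI : ∀ j, t j ∈ Set.Ioo 0 β) (F : (V → Fin θ) → ℝ) :
    Integrable (fun r => F (σ.conf r)) (timeMeasure β) := by
  obtain ⟨C, hC⟩ := (Set.finite_range fun s => ‖F s‖).bddAbove
  exact Integrable.of_bound (hσ.aemeasurable hI F).aestronglyMeasurable C
    (Filter.Eventually.of_forall fun r => hC ⟨_, rfl⟩)

variable [Fintype G.edgeSet]

/-- The shift by `c` makes the exponent nonnegative, so its power series lives in `ℝ≥0∞`; the `k`-th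
power of the time integral is an integral over `k` independent times. -/
theorem ofReal_exp_neg_sum_edgeEnergy [Finite V] {J : Type*} [Fintype J] (hβ : 0 < β)
    {σ : SpinConfig V θ β} {t : J → ℝ} (hσ : AdaptedTo t σ) (hI : ∀ j, t j ∈ Set.Ioo 0 β)
    (f : Fin θ → ℝ) (v : V → ℝ) {c : ℝ} (hc : ∀ s, potential G f v s ≤ c) :
    ENNReal.ofReal (Real.exp (-∑ e : G.edgeSet, edgeEnergy f v σ (e : Sym2 V))) =
      ENNReal.ofReal (Real.exp (-(β * c))) * ∑' k : ℕ, (k ! : ℝ≥0∞)⁻¹ *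
        ∫⁻ r, ∏ i, ENNReal.ofReal (c - potential G f v (σ.conf (r i)))
          ∂Measure.pi fun _ : Fin k => timeMeasure β := by
  have hint := fun F : (V → Fin θ) → ℝ => hσ.integrable hI F
  have hE : ∑ e : G.edgeSet, edgeEnergy f v σ (e : Sym2 V) =
      ∫ r, potential G f v (σ.conf r) ∂timeMeasure β := by
    simp only [edgeEnergy_eq hβ, potential]
    rw [integral_finsetSum]
    exact fun e _ => hint fun s => edgePotential f v s e
  have hE' : ∫ r, (c - potential G f v (σ.conf r)) ∂timeMeasure β =
      β * c - ∫ r, potential G f v (σ.conf r) ∂timeMeasure β := by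
    rw [integral_sub (integrable_const c) (hint _), integral_const]
    simp [timeMeasure, hβ.le, Measure.real]
  have hnn : 0 ≤ ∫ r, (c - potential G f v (σ.conf r)) ∂timeMeasure β :=
    integral_nonneg fun r => sub_nonneg.2 (hc _)
  have hexp : -∑ e : G.edgeSet, edgeEnergy f v σ (e : Sym2 V) =
      -(β * c) + ∫ r, (c - potential G f v (σ.conf r)) ∂timeMeasure β := by
    rw [hE', hE]
    ring
  rw [hexp, Real.exp_add, ENNReal.ofReal_mul (Real.exp_pos _).le, ofReal_exp_eq_tsum hnn,
    ofReal_integral_eq_lintegral_ofReal (hint fun s => c - potential G f v s)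
      (Filter.Eventually.of_forall fun r => sub_nonneg.2 (hc _))]
  congr 1
  refine tsum_congr fun k => ?_
  congr 1
  exact (lintegral_pi_prod _ (hσ.aemeasurable hI fun s =>
    ENNReal.ofReal (c - potential G f v s)) k).symm

theorem ae_ae_goodTimes_elim {J J' : Type*} [Fintype J] [Fintype J'] (β : ℝ) :
    ∀ᵐ t ∂Measure.pi (fun _ : J => timeMeasure β), ∀ᵐ r ∂Measure.pi (fun _ : J' => timeMeasure β),
      GoodTimes β (Sum.elim t r) := by
  have hp := (measurePreserving_sumPiEquivProdPi (fun _ : J ⊕ J' => timeMeasure β)).symm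
  refine Measure.ae_ae_of_ae_prod (p := fun z => GoodTimes β (Sum.elim z.1 z.2)) ?_
  filter_upwards [hp.quasiMeasurePreserving.ae (ae_goodTimes β)] with z hz
  exact hz

theorem aemeasurable_lintegral_pathSum [Fintype V] [DecidableEq V] (hβ : 0 < β) {J J' : Type*}
    [Fintype J] [Fintype J'] (W : J ⊕ J' → Matrix (V → Fin θ) (V → Fin θ) ℝ≥0∞) :
    AEMeasurable (fun t => ∫⁻ r, pathSum β (Sum.elim t r) W
      ∂Measure.pi fun _ : J' => timeMeasure β) (Measure.pi fun _ : J => timeMeasure β) := by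
  have hp := (measurePreserving_sumPiEquivProdPi (fun _ : J ⊕ J' => timeMeasure β)).symm
  exact ((aemeasurable_pathSum hβ W).comp_quasiMeasurePreserving
    hp.quasiMeasurePreserving).lintegral_prod_right'

theorem lintegral_tsum_compatible [Fintype V] [DecidableEq V] (hβ : 0 < β) (f : Fin θ → ℝ)
    (v : V → ℝ) {c : ℝ} (hc : ∀ s, potential G f v s ≤ c) {n : ℕ}
    (l : Fin n → G.edgeSet × Kind) :
    ∫⁻ t, ∑' σ : {σ : SpinConfig V θ β // Compatible (⟨n, labelled l t⟩ : Realization G) σ},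
        ENNReal.ofReal (Real.exp (-∑ e : G.edgeSet, edgeEnergy f v σ.1 (e : Sym2 V)))
        ∂Measure.pi (fun _ : Fin n => timeMeasure β) =
      ENNReal.ofReal (Real.exp (-(β * c))) * ∑' k : ℕ, (k ! : ℝ≥0∞)⁻¹ *
        pathIntegral β (Sum.elim
          (fun j : Fin n => transitionMatrix ℝ≥0∞ ((l j).1 : Sym2 V) (l j).2)
          fun _ : Fin k => Matrix.diagonal fun s => ENNReal.ofReal (c - potential G f v s)) := by
  set H : (V → Fin θ) → ℝ≥0∞ := fun s => ENNReal.ofReal (c - potential G f v s)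
  have key : ∀ᵐ t ∂Measure.pi (fun _ : Fin n => timeMeasure β),
      ∑' σ : {σ : SpinConfig V θ β // Compatible (⟨n, labelled l t⟩ : Realization G) σ},
        ENNReal.ofReal (Real.exp (-∑ e : G.edgeSet, edgeEnergy f v σ.1 (e : Sym2 V))) =
      ENNReal.ofReal (Real.exp (-(β * c))) * ∑' k : ℕ, (k ! : ℝ≥0∞)⁻¹ *
        ∫⁻ r, pathSum β (Sum.elim t r) (Sum.elim
          (fun j : Fin n => transitionMatrix ℝ≥0∞ ((l j).1 : Sym2 V) (l j).2)
          fun _ : Fin k => Matrix.diagonal H) ∂Measure.pi fun _ : Fin k => timeMeasure β := by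
    have hk : ∀ᵐ t ∂Measure.pi (fun _ : Fin n => timeMeasure β), ∀ k : ℕ,
        ∀ᵐ r ∂Measure.pi (fun _ : Fin k => timeMeasure β), GoodTimes β (Sum.elim t r) :=
      ae_all_iff.2 fun k => ae_ae_goodTimes_elim β
    filter_upwards [ae_goodTimes β, hk] with t ht hk
    -- Finiteness supplies the countability needed to exchange the sum over `σ` with the integral
    -- over insertion times.
    have hfin := finite_compatible (θ := θ) (ξ := (⟨n, labelled l t⟩ : Realization G)) hβ ht
    have had : ∀ σ : {σ : SpinConfig V θ β // Compatible (⟨n, labelled l t⟩ : Realization G) σ},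
        AdaptedTo t σ.1 := fun σ x r hr => σ.2.2 x r fun j _ => hr j
    simp only [fun σ : {σ : SpinConfig V θ β // Compatible (⟨n, labelled l t⟩ : Realization G) σ}
      => ofReal_exp_neg_sum_edgeEnergy hβ (had σ) ht.2 f v hc]
    rw [ENNReal.tsum_mul_left, ENNReal.tsum_comm]
    congr 1
    refine tsum_congr fun k => ?_
    rw [ENNReal.tsum_mul_left, ← lintegral_tsum]
    · congr 1
      refine lintegral_congr_ae ?_
      filter_upwards [hk k] with r hr
      exact tsum_compatible_prod (ξ := (⟨n, labelled l t⟩ : Realization G)) hβ hr H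
    · intro σ
      exact Finset.aemeasurable_fun_prod _ fun i _ =>
        ((had σ).aemeasurable ht.2 H).comp_quasiMeasurePreserving
          (Measure.quasiMeasurePreserving_eval _ i)
  rw [lintegral_congr_ae key, lintegral_const_mul' _ _ ENNReal.ofReal_ne_top, lintegral_tsum]
  · congr 1
    refine tsum_congr fun k => ?_
    rw [lintegral_const_mul' _ _ (ENNReal.inv_ne_top.2
      (by exact_mod_cast Nat.factorial_ne_zero k)), pathIntegral_sum hβ]
  · exact fun k => (aemeasurable_lintegral_pathSum hβ _).const_mul _

variable (G) in
/-- The generator of the transfer operators. -/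
def generator [Fintype V] [DecidableEq V] (u : ℝ) (f : Fin θ → ℝ) (v : V → ℝ) :
    Matrix (V → Fin θ) (V → Fin θ) ℝ :=
  ∑ e : G.edgeSet, ∑ κ, kindWeight u κ • transitionMatrix ℝ (e : Sym2 V) κ -
    Matrix.diagonal (potential G f v)

theorem generator_add_smul_one [Fintype V] [DecidableEq V] (f : Fin θ → ℝ) (v : V → ℝ) (c : ℝ) :
    generator G u f v + c • (1 : Matrix (V → Fin θ) (V → Fin θ) ℝ) =
      ∑ l : G.edgeSet × Kind, kindWeight u l.2 • transitionMatrix ℝ (l.1 : Sym2 V) l.2 +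
        Matrix.diagonal fun s => c - potential G f v s := by
  rw [generator, ← Fintype.sum_prod_type' fun (e : G.edgeSet) κ =>
    kindWeight u κ • transitionMatrix (θ := θ) ℝ (e : Sym2 V) κ, ← Matrix.diagonal_one,
    ← Matrix.diagonal_smul, sub_add, Matrix.diagonal_sub, sub_eq_add_neg, Matrix.diagonal_neg]
  congr 2
  ext s
  simp

theorem kindWeight_nonneg (hu : u ∈ Set.Icc (0 : ℝ) 1) (κ : Kind) : 0 ≤ kindWeight u κ := by
  cases κ
  · exact hu.1
  · exact sub_nonneg.2 hu.2

theorem smul_transitionMatrix_nonneg (hu : u ∈ Set.Icc (0 : ℝ) 1) (e : Sym2 V) (κ : Kind)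
    (s s' : V → Fin θ) : 0 ≤ (kindWeight u κ • transitionMatrix (θ := θ) ℝ e κ) s s' := by
  refine mul_nonneg (kindWeight_nonneg hu _) ?_
  simp only [transitionMatrix, Matrix.of_apply]
  split_ifs <;> simp

theorem diagonal_sub_potential_nonneg [Fintype V] {f : Fin θ → ℝ} {v : V → ℝ} {c : ℝ}
    (hc : ∀ s, potential G f v s ≤ c) (s s' : V → Fin θ) :
    0 ≤ Matrix.diagonal (fun s => c - potential G f v s) s s' := by
  rw [Matrix.diagonal_apply]
  split_ifs
  · exact sub_nonneg.2 (hc _)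
  · exact le_rfl

theorem generator_add_smul_one_nonneg [Fintype V] [DecidableEq V] (hu : u ∈ Set.Icc (0 : ℝ) 1)
    {f : Fin θ → ℝ} {v : V → ℝ} {c : ℝ} (hc : ∀ s, potential G f v s ≤ c) (s s' : V → Fin θ) :
    0 ≤ (generator G u f v + c • (1 : Matrix (V → Fin θ) (V → Fin θ) ℝ)) s s' := by
  rw [generator_add_smul_one, Matrix.add_apply, Matrix.sum_apply]
  exact add_nonneg (Finset.sum_nonneg fun l _ => smul_transitionMatrix_nonneg hu l.1 l.2 s s')
    (diagonal_sub_potential_nonneg hc s s')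

variable (G) in
theorem exists_potential_le [Finite V] (f : Fin θ → ℝ) (v : V → ℝ) :
    ∃ c, ∀ s, potential G f v s ≤ c := by
  obtain ⟨c, hc⟩ := (Set.finite_range (potential G f v)).bddAbove
  exact ⟨c, fun s => hc ⟨s, rfl⟩⟩

theorem trace_exp_generator_nonneg [Fintype V] [DecidableEq V] (hβ : 0 ≤ β)
    (hu : u ∈ Set.Icc (0 : ℝ) 1) (f : Fin θ → ℝ) (v : V → ℝ) :
    0 ≤ (NormedSpace.exp (β • generator G u f v)).trace := by
  obtain ⟨c, hc⟩ := exists_potential_le G f v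
  have h := trace_exp_nonneg (X := β • (generator G u f v + c • 1)) fun s s' =>
    mul_nonneg hβ (generator_add_smul_one_nonneg hu hc s s')
  rw [smul_add, smul_smul, exp_add_smul_one, Matrix.trace_smul, smul_eq_mul] at h
  exact nonneg_of_mul_nonneg_right h (Real.exp_pos _)

/-- The Feynman–Kac formula. The prefactor is the Poisson normalisation: the intensities `u` and `1
- u` add to one, so the total mass is the number of edges times `β`. -/
theorem partitionFunction_eq [Fintype V] [DecidableEq V] (hβ : 0 < β)
    (hu : u ∈ Set.Icc (0 : ℝ) 1) (f : Fin θ → ℝ) (v : V → ℝ) :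
    partitionFunction G β u f v = ENNReal.ofReal (Real.exp (-(Fintype.card G.edgeSet * β)) *
      (NormedSpace.exp (β • generator G u f v)).trace) := by
  obtain ⟨c, hc⟩ := exists_potential_le G f v
  have hmass : (intensity G β u Set.univ).toReal = Fintype.card G.edgeSet * β := by
    rw [intensity_univ, ← ENNReal.ofReal_add hu.1 (sub_nonneg.2 hu.2)]
    simp [hβ.le]
  set H : (V → Fin θ) → ℝ≥0∞ := fun s => ENNReal.ofReal (c - potential G f v s)
  set A : Matrix (V → Fin θ) (V → Fin θ) ℝ≥0∞ := ∑ l : G.edgeSet × Kind,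
    ENNReal.ofReal (kindWeight u l.2) • transitionMatrix ℝ≥0∞ (l.1 : Sym2 V) l.2
  have h₁ : partitionFunction G β u f v =
      ENNReal.ofReal (Real.exp (-(Fintype.card G.edgeSet * β))) *
        (ENNReal.ofReal (Real.exp (-(β * c))) * ∑' n : ℕ, (n ! : ℝ≥0∞)⁻¹ * ∑' k : ℕ,
          (k ! : ℝ≥0∞)⁻¹ * pathIntegral β
            (Sum.elim (fun _ : Fin n => A) fun _ : Fin k => Matrix.diagonal H)) := by
    rw [partitionFunction, lintegral_poissonProcess, hmass, ← ENNReal.tsum_mul_left,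
      ← ENNReal.tsum_mul_left]
    refine tsum_congr fun n => ?_
    rw [lintegral_pi_intensity]
    simp only [lintegral_tsum_compatible hβ f v hc]
    have hl : ∑ l : Fin n → G.edgeSet × Kind, (∏ j, ENNReal.ofReal (kindWeight u (l j).2)) *
        (ENNReal.ofReal (Real.exp (-(β * c))) * ∑' k : ℕ, (k ! : ℝ≥0∞)⁻¹ *
          pathIntegral β (Sum.elim
            (fun j : Fin n => transitionMatrix ℝ≥0∞ ((l j).1 : Sym2 V) (l j).2)
            fun _ : Fin k => Matrix.diagonal H)) =
        ENNReal.ofReal (Real.exp (-(β * c))) * ∑' k : ℕ, (k ! : ℝ≥0∞)⁻¹ *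
          pathIntegral β (Sum.elim (fun _ : Fin n => A) fun _ : Fin k => Matrix.diagonal H) := by
      simp only [mul_left_comm _ (ENNReal.ofReal (Real.exp (-(β * c))))]
      rw [← Finset.mul_sum]
      congr 1
      simp only [← ENNReal.tsum_mul_left]
      rw [← Summable.tsum_finsetSum fun _ _ => ENNReal.summable]
      refine tsum_congr fun k => ?_
      simp only [mul_left_comm _ ((k ! : ℝ≥0∞)⁻¹), ← Finset.mul_sum]
      congr 1
      simp only [pathIntegral]
      rw [← lintegral_congr fun t => sum_labels_pathSum t
        (fun l : G.edgeSet × Kind => ENNReal.ofReal (kindWeight u l.2))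
        (fun l => transitionMatrix ℝ≥0∞ (l.1 : Sym2 V) l.2)
        (fun _ : Fin k => Matrix.diagonal H), lintegral_finsetSum']
      · refine Finset.sum_congr rfl fun l _ => ?_
        rw [lintegral_const_mul']
        exact ENNReal.prod_ne_top fun _ _ => ENNReal.ofReal_ne_top
      · exact fun l _ => (aemeasurable_pathSum hβ _).const_mul _
    rw [hl, div_eq_mul_inv, ENNReal.ofReal_mul (Real.exp_pos _).le,
      ENNReal.ofReal_inv_of_pos (by positivity), ENNReal.ofReal_natCast]
    ring
  have h₂ : A + Matrix.diagonal H =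
      (generator G u f v + c • (1 : Matrix (V → Fin θ) (V → Fin θ) ℝ)).map ENNReal.ofReal := by
    rw [generator_add_smul_one]
    ext s s'
    rw [Matrix.map_apply, Matrix.add_apply, Matrix.add_apply, Matrix.sum_apply, ENNReal.ofReal_add
      (Finset.sum_nonneg fun l _ => smul_transitionMatrix_nonneg hu l.1 l.2 s s')
      (diagonal_sub_potential_nonneg hc s s'),
      ENNReal.ofReal_sum_of_nonneg fun l _ => smul_transitionMatrix_nonneg hu l.1 l.2 s s']
    refine congrArg₂ (· + ·) ((Matrix.sum_apply s s' Finset.univ _).trans ?_) ?_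
    · refine Finset.sum_congr rfl fun l _ => ?_
      rw [Matrix.smul_apply, Matrix.smul_apply, smul_eq_mul, smul_eq_mul,
        ENNReal.ofReal_mul (kindWeight_nonneg hu _)]
      congr 1
      simp only [transitionMatrix, Matrix.of_apply]
      split_ifs <;> simp
    · rw [Matrix.diagonal_apply, Matrix.diagonal_apply]
      split_ifs <;> simp [H]
  -- The shift contributes `exp (β c)` to the trace, cancelling the factor `exp (-(β c))` of the
  -- power expansion.
  rw [h₁, tsum_tsum_pathIntegral hβ, h₂, tsum_trace_pow_map_ofReal
    (generator_add_smul_one_nonneg hu hc) hβ.le, smul_add, smul_smul,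
    exp_add_smul_one, Matrix.trace_smul, smul_eq_mul, ← ENNReal.ofReal_mul (Real.exp_pos _).le,
    ← mul_assoc (Real.exp (-(β * c))), ← Real.exp_add, neg_add_cancel, Real.exp_zero, one_mul,
    ← ENNReal.ofReal_mul (Real.exp_pos _).le]

end FeynmanKac

open scoped Kronecker

/-! ### Reflection positive families of matrices -/

section ReflectionPositive

variable {T W : Type*} [Fintype T] [DecidableEq T]

omit [Fintype T] [DecidableEq T] in
/-- A family of matrices on a doubled space is reflection positive if it is a sum of terms of the
form `C w₁ ⊗ C w₂`. -/
def IsReflectionPositive (X : W → W → Matrix (T × T) (T × T) ℝ) : Prop :=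
  ∃ (ι : Type) (_ : Fintype ι) (C : ι → W → Matrix T T ℝ),
    ∀ w₁ w₂, X w₁ w₂ = ∑ i, C i w₁ ⊗ₖ C i w₂

namespace IsReflectionPositive

variable {X Y : W → W → Matrix (T × T) (T × T) ℝ}

omit [Fintype T] [DecidableEq T] in
theorem kronecker (C : W → Matrix T T ℝ) :
    IsReflectionPositive fun w₁ w₂ => C w₁ ⊗ₖ C w₂ :=
  ⟨Unit, inferInstance, fun _ => C, fun w₁ w₂ => by simp⟩

omit [Fintype T] in
theorem one : IsReflectionPositive fun _ _ : W => (1 : Matrix (T × T) (T × T) ℝ) := by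
  simpa using kronecker fun _ : W => (1 : Matrix T T ℝ)

omit [Fintype T] [DecidableEq T] in
theorem zero : IsReflectionPositive fun _ _ : W => (0 : Matrix (T × T) (T × T) ℝ) :=
  ⟨Empty, inferInstance, fun _ _ => 0, fun w₁ w₂ => by simp⟩

omit [Fintype T] [DecidableEq T] in
theorem add (hX : IsReflectionPositive X) (hY : IsReflectionPositive Y) :
    IsReflectionPositive fun w₁ w₂ => X w₁ w₂ + Y w₁ w₂ := by
  obtain ⟨ι, _, C, hC⟩ := hX
  obtain ⟨κ, _, D, hD⟩ := hY
  exact ⟨ι ⊕ κ, inferInstance, Sum.elim C D, fun w₁ w₂ => by simp [hC, hD]⟩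

omit [Fintype T] [DecidableEq T] in
theorem sum {ι : Type*} (s : Finset ι) {X : ι → W → W → Matrix (T × T) (T × T) ℝ}
    (hX : ∀ i ∈ s, IsReflectionPositive (X i)) :
    IsReflectionPositive fun w₁ w₂ => ∑ i ∈ s, X i w₁ w₂ := by
  classical
  induction s using Finset.induction_on with
  | empty => simpa using zero
  | insert i s hi ih =>
    simp only [Finset.sum_insert hi]
    exact (hX i (Finset.mem_insert_self _ _)).add
      (ih fun j hj => hX j (Finset.mem_insert_of_mem hj))

omit [Fintype T] [DecidableEq T] in
theorem smul (hX : IsReflectionPositive X) {c : ℝ} (hc : 0 ≤ c) :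
    IsReflectionPositive fun w₁ w₂ => c • X w₁ w₂ := by
  obtain ⟨ι, _, C, hC⟩ := hX
  refine ⟨ι, inferInstance, fun i w => Real.sqrt c • C i w, fun w₁ w₂ => ?_⟩
  simp only [hC, Finset.smul_sum, Matrix.smul_kronecker, Matrix.kronecker_smul, smul_smul,
    Real.mul_self_sqrt hc]

omit [DecidableEq T] in
theorem mul (hX : IsReflectionPositive X) (hY : IsReflectionPositive Y) :
    IsReflectionPositive fun w₁ w₂ => X w₁ w₂ * Y w₁ w₂ := by
  obtain ⟨ι, _, C, hC⟩ := hX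
  obtain ⟨κ, _, D, hD⟩ := hY
  refine ⟨ι × κ, inferInstance, fun i w => C i.1 w * D i.2 w, fun w₁ w₂ => ?_⟩
  simp only [hC, hD, Finset.sum_mul_sum, Matrix.mul_kronecker_mul, Fintype.sum_prod_type]

theorem pow (hX : IsReflectionPositive X) (N : ℕ) :
    IsReflectionPositive fun w₁ w₂ => X w₁ w₂ ^ N := by
  induction N with
  | zero => simpa using one
  | succ N ih => simpa only [pow_succ] using ih.mul hX

omit [DecidableEq T] in
-- The trace of `C i w₁ ⊗ C i w₂` factorises, leaving the Cauchy–Schwarz inequality for the real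
-- vectors `i ↦ Tr (C i w)`.
theorem trace_sq_le (hX : IsReflectionPositive X) (w₁ w₂ : W) :
    (X w₁ w₂).trace ^ 2 ≤ (X w₁ w₁).trace * (X w₂ w₂).trace := by
  obtain ⟨ι, _, C, hC⟩ := hX
  simp only [hC, Matrix.trace_sum, Matrix.trace_kronecker]
  simpa only [sq] using Finset.sum_mul_sq_le_sq_mul_sq Finset.univ
    (fun i => (C i w₁).trace) fun i => (C i w₂).trace

theorem trace_exp_sq_le (hX : IsReflectionPositive X) (w₁ w₂ : W) :
    (NormedSpace.exp (X w₁ w₂)).trace ^ 2 ≤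
      (NormedSpace.exp (X w₁ w₁)).trace * (NormedSpace.exp (X w₂ w₂)).trace := by
  have h : ∀ w₁ w₂, Filter.Tendsto
      (fun n : ℕ => (∑ N ∈ Finset.range n, (N ! : ℝ)⁻¹ • X w₁ w₂ ^ N).trace) Filter.atTop
      (𝓝 (NormedSpace.exp (X w₁ w₂)).trace) := by
    intro w₁ w₂
    simpa only [Matrix.trace_sum, Matrix.trace_smul, smul_eq_mul] using
      (hasSum_trace_exp (X w₁ w₂)).tendsto_sum_nat
  refine le_of_tendsto_of_tendsto' ((h w₁ w₂).pow 2) ((h w₁ w₁).mul (h w₂ w₂)) fun n => ?_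
  exact (sum _ fun N _ => (hX.pow N).smul (c := (N ! : ℝ)⁻¹) (by positivity)).trace_sq_le w₁ w₂

end IsReflectionPositive

section Limit

attribute [local instance] Matrix.linftyOpNormedRing Matrix.linftyOpNormedAlgebra

theorem tendsto_trace_exp {S : Type*} [Fintype S] [DecidableEq S] (K Y : Matrix S S ℝ) :
    Filter.Tendsto (fun ε : ℝ => (NormedSpace.exp (K + ε • Y)).trace) (𝓝[>] 0)
      (𝓝 (NormedSpace.exp K).trace) := by
  have h : Continuous fun ε : ℝ => (NormedSpace.exp (K + ε • Y)).trace := by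
    have h₁ : Continuous fun X : Matrix S S ℝ => X.trace := continuous_id.matrix_trace
    have h₂ : Continuous fun ε : ℝ => NormedSpace.exp (K + ε • Y) :=
      NormedSpace.exp_continuous.comp (by fun_prop)
    exact h₁.comp h₂
  simpa using (h.tendsto 0).mono_left nhdsWithin_le_nhds

end Limit

/-- **Reflection positivity**: the Cauchy–Schwarz inequality for the traces of the exponentials of
`A w₁ ⊗ 1 + 1 ⊗ A w₂ + X w₁ w₂`, where `X` is reflection positive. -/
theorem trace_exp_sq_le_of_isReflectionPositive (A : W → Matrix T T ℝ)
    {X : W → W → Matrix (T × T) (T × T) ℝ} (hX : IsReflectionPositive X) (w₁ w₂ : W) :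
    (NormedSpace.exp (A w₁ ⊗ₖ 1 + 1 ⊗ₖ A w₂ + X w₁ w₂)).trace ^ 2 ≤
      (NormedSpace.exp (A w₁ ⊗ₖ 1 + 1 ⊗ₖ A w₁ + X w₁ w₁)).trace *
        (NormedSpace.exp (A w₂ ⊗ₖ 1 + 1 ⊗ₖ A w₂ + X w₂ w₂)).trace := by
  have key : ∀ ε : ℝ, 0 < ε →
      (NormedSpace.exp (A w₁ ⊗ₖ 1 + 1 ⊗ₖ A w₂ + X w₁ w₂ + ε • (A w₁ ⊗ₖ A w₂))).trace ^ 2 ≤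
      (NormedSpace.exp (A w₁ ⊗ₖ 1 + 1 ⊗ₖ A w₁ + X w₁ w₁ + ε • (A w₁ ⊗ₖ A w₁))).trace *
        (NormedSpace.exp (A w₂ ⊗ₖ 1 + 1 ⊗ₖ A w₂ + X w₂ w₂ + ε • (A w₂ ⊗ₖ A w₂))).trace := by
    intro ε hε
    -- Completing the product: `ε⁻¹ (1 + εA) ⊗ (1 + εA')` equals `A ⊗ 1 + 1 ⊗ A'` plus the scalar
    -- `ε⁻¹` and an error `ε A ⊗ A'`.
    have hpos := ((IsReflectionPositive.kronecker fun w => 1 + ε • A w).smul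
      (inv_pos.2 hε).le).add hX
    have hexp : ∀ w₁ w₂, ε⁻¹ • ((1 + ε • A w₁) ⊗ₖ (1 + ε • A w₂)) + X w₁ w₂ =
        A w₁ ⊗ₖ 1 + 1 ⊗ₖ A w₂ + X w₁ w₂ + ε • (A w₁ ⊗ₖ A w₂) + ε⁻¹ • 1 := by
      intro w₁ w₂
      simp only [Matrix.add_kronecker, Matrix.kronecker_add, Matrix.smul_kronecker,
        Matrix.kronecker_smul, Matrix.one_kronecker_one, smul_add, smul_smul,
        inv_mul_cancel₀ hε.ne', one_smul]
      rw [← mul_assoc, inv_mul_cancel₀ hε.ne', one_mul]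
      abel
    have h := hpos.trace_exp_sq_le w₁ w₂
    simp only [hexp, exp_add_smul_one, Matrix.trace_smul, smul_eq_mul] at h
    have he := Real.exp_pos ε⁻¹
    -- The divergent factor `exp ε⁻¹` occurs squared on both sides and cancels before the limit.
    rw [mul_pow, mul_mul_mul_comm, ← sq] at h
    exact le_of_mul_le_mul_left h (by positivity)
  refine le_of_tendsto_of_tendsto ((tendsto_trace_exp _ (A w₁ ⊗ₖ A w₂)).pow 2)
    ((tendsto_trace_exp _ (A w₁ ⊗ₖ A w₁)).mul (tendsto_trace_exp _ (A w₂ ⊗ₖ A w₂))) ?_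
  filter_upwards [self_mem_nhdsWithin] with ε hε
  exact key ε hε

theorem trace_exp_reindex {S S' : Type*} [Fintype S] [DecidableEq S] [Fintype S'] [DecidableEq S']
    (e : S ≃ S') (X : Matrix S S ℝ) :
    (NormedSpace.exp (Matrix.reindex e e X)).trace = (NormedSpace.exp X).trace := by
  refine (hasSum_trace_exp _).unique ?_
  have : ∀ N : ℕ, (Matrix.reindex e e X ^ N).trace = (X ^ N).trace := by
    intro N
    have h := map_pow (Matrix.reindexAlgEquiv ℝ ℝ e) X N
    rw [Matrix.coe_reindexAlgEquiv] at h
    rw [← h]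
    exact e.symm.sum_comp fun i => (X ^ N) i i
  simpa only [this] using hasSum_trace_exp X

end ReflectionPositive

/-! ### The generator as a sum over pairs of sites -/

theorem sum_adj_eq_two_mul_sum_edgeSet {V : Type*} [Fintype V] [DecidableEq V] (G : SimpleGraph V)
    [Fintype G.edgeSet] [DecidableRel G.Adj] (F : Sym2 V → ℝ) :
    ∑ x, ∑ y, (if G.Adj x y then F s(x, y) else 0) = 2 * ∑ e : G.edgeSet, F e := by
  have h : ∀ x y, (if G.Adj x y then F s(x, y) else 0) =
      ∑ e : G.edgeSet, if s(x, y) = (e : Sym2 V) then F e else 0 := by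
    intro x y
    split_ifs with hxy
    · rw [Finset.sum_eq_single (⟨s(x, y), hxy⟩ : G.edgeSet)]
      · simp
      · intro e _ he
        exact if_neg fun h => he (Subtype.ext h.symm)
      · simp
    · refine (Finset.sum_eq_zero fun e _ => if_neg fun h => hxy ?_).symm
      have := e.2
      rwa [← h] at this
  simp only [h]
  rw [Finset.sum_congr rfl fun x _ => Finset.sum_comm, Finset.sum_comm, Finset.mul_sum]
  refine Finset.sum_congr rfl fun e _ => ?_
  obtain ⟨e, he⟩ := e
  induction e with
  | h a b =>
    have hab : a ≠ b := G.ne_of_adj he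
    rw [← Fintype.sum_prod_type', ← Finset.sum_filter]
    have : (Finset.univ.filter fun p : V × V => s(p.1, p.2) = s(a, b)) = {(a, b), (b, a)} := by
      ext p
      simp [Prod.ext_iff]
    rw [this, Finset.sum_pair (by simp [hab])]
    ring

open Classical in
/-- The indicator of a proposition. -/
def ind (p : Prop) : ℝ := if p then 1 else 0

theorem ind_of {p : Prop} (h : p) : ind p = 1 := if_pos h

theorem ind_not {p : Prop} (h : ¬ p) : ind p = 0 := if_neg h

theorem ind_and (p q : Prop) : ind (p ∧ q) = ind p * ind q := by
  by_cases hp : p <;> by_cases hq : q <;> simp [ind, hp, hq]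

theorem ind_congr {p q : Prop} (h : p ↔ q) : ind p = ind q := congrArg ind (propext h)

theorem sum_mul_ind {ι : Type*} [Fintype ι] (h : ι → ℝ) (i : ι) : ∑ j, h j * ind (i = j) = h i := by
  rw [Finset.sum_eq_single i]
  · rw [ind_of rfl, mul_one]
  · intro j _ hj
    rw [ind_not hj.symm, mul_zero]
  · simp

/-- The contribution of a pair of sites to the generator. -/
def pairTerm {V : Type*} {θ : ℕ} (u : ℝ) (f : Fin θ → ℝ) (v : V → ℝ) (x y : V)
    (s s' : V → Fin θ) : ℝ :=
  ind (∀ z, z ≠ x → z ≠ y → s z = s' z) *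
      (u * ind (s' x = s y ∧ s' y = s x) + (1 - u) * ind (s' x = s' y ∧ s x = s y)) -
    ind (s = s') * ((f (s x) - f (s y)) * (v x - v y) + 1 / 4 * (v x - v y) ^ 2)

section Pairs

variable {V : Type*} {θ : ℕ} {u : ℝ} {f : Fin θ → ℝ}

theorem transitionAllowed_mk (x y : V) (κ : Kind) (s s' : V → Fin θ) :
    TransitionAllowed s(x, y) κ s s' ↔
      (∀ z, z ≠ x → z ≠ y → s z = s' z) ∧ (s' x, s' y, s x, s y) ∈ κ.allowed θ := by
  refine and_congr (forall_congr' fun z => ?_) ⟨fun h => h x y rfl, fun h a b hab => ?_⟩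
  · rw [Sym2.mem_iff, not_or, and_imp]
  · rcases Sym2.eq_iff.1 hab with ⟨rfl, rfl⟩ | ⟨rfl, rfl⟩
    · exact h
    · cases κ
      · obtain ⟨a, b, h⟩ := h
        simp only [Prod.mk.injEq] at h
        exact ⟨b, a, by simp [h]⟩
      · obtain ⟨a, b, h⟩ := h
        simp only [Prod.mk.injEq] at h
        exact ⟨a, b, by simp [h]⟩

theorem mem_allowed_cross (a b c d : Fin θ) :
    (a, b, c, d) ∈ Kind.cross.allowed θ ↔ a = d ∧ b = c := by
  constructor
  · rintro ⟨p, q, h⟩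
    simp only [Prod.mk.injEq] at h
    exact ⟨by simp [h], by simp [h]⟩
  · rintro ⟨rfl, rfl⟩
    exact ⟨a, b, rfl⟩

theorem mem_allowed_doubleBar (a b c d : Fin θ) :
    (a, b, c, d) ∈ Kind.doubleBar.allowed θ ↔ a = b ∧ c = d := by
  constructor
  · rintro ⟨p, q, h⟩
    simp only [Prod.mk.injEq] at h
    exact ⟨by simp [h], by simp [h]⟩
  · rintro ⟨rfl, rfl⟩
    exact ⟨c, a, rfl⟩

theorem pairTerm_eq [DecidableEq V] [Fintype V] (v : V → ℝ) (x y : V) (s s' : V → Fin θ) :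
    ∑ κ, kindWeight u κ * transitionMatrix ℝ s(x, y) κ s s' -
      Matrix.diagonal (fun s => edgePotential f v s s(x, y)) s s' = pairTerm u f v x y s s' := by
  rw [sum_kind]
  simp only [transitionMatrix, Matrix.of_apply, transitionAllowed_mk, mem_allowed_cross,
    mem_allowed_doubleBar, Matrix.diagonal_apply, edgePotential, Sym2.lift_mk, pairTerm,
    kindWeight]
  congr 1
  · by_cases h : ∀ z, z ≠ x → z ≠ y → s z = s' z
    · rw [ind_of h, one_mul]
      simp only [iff_true_intro h, true_and]
      simp [ind]
    · rw [ind_not h, zero_mul]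
      simp only [iff_false_intro h, false_and, if_false, mul_zero, add_zero]
  · by_cases h : s = s' <;> simp [ind, h]

open Classical in
theorem generator_apply [DecidableEq V] [Fintype V] (G : SimpleGraph V) [Fintype G.edgeSet]
    (v : V → ℝ) (s s' : V → Fin θ) :
    generator G u f v s s' =
      1 / 2 * ∑ x, ∑ y, if G.Adj x y then pairTerm u f v x y s s' else 0 := by
  simp only [← pairTerm_eq]
  rw [sum_adj_eq_two_mul_sum_edgeSet G fun e => ∑ κ, kindWeight u κ *
    transitionMatrix ℝ e κ s s' - Matrix.diagonal (fun s => edgePotential f v s e) s s',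
    ← mul_assoc, one_div, inv_mul_cancel₀ two_ne_zero, one_mul, generator, Matrix.sub_apply,
    Finset.sum_sub_distrib, Matrix.sum_apply]
  refine congrArg₂ (· - ·) (Finset.sum_congr rfl fun e _ => ?_) ?_
  · rw [Matrix.sum_apply]
    rfl
  · simp only [Matrix.diagonal_apply, potential]
    split_ifs <;> simp

theorem pairTerm_comm (v : V → ℝ) (x y : V) (s s' : V → Fin θ) :
    pairTerm u f v x y s s' = pairTerm u f v y x s s' := by
  have h₁ : (∀ z, z ≠ x → z ≠ y → s z = s' z) ↔ ∀ z, z ≠ y → z ≠ x → s z = s' z :=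
    forall_congr' fun z => ⟨fun h h₁ h₂ => h h₂ h₁, fun h h₁ h₂ => h h₂ h₁⟩
  have h₂ : (s' x = s y ∧ s' y = s x) ↔ (s' y = s x ∧ s' x = s y) := and_comm
  have h₃ : (s' x = s' y ∧ s x = s y) ↔ (s' y = s' x ∧ s y = s x) := and_congr eq_comm eq_comm
  rw [pairTerm, pairTerm, ind_congr h₁, ind_congr h₂, ind_congr h₃]
  ring

theorem pairTerm_equiv {V' : Type*} (e : V' ≃ V) (v : V → ℝ) (x y : V') (s s' : V' → Fin θ) :
    pairTerm u f v (e x) (e y) (s ∘ e.symm) (s' ∘ e.symm) = pairTerm u f (v ∘ e) x y s s' := by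
  have h₁ : (∀ z, z ≠ e x → z ≠ e y → (s ∘ e.symm) z = (s' ∘ e.symm) z) ↔
      ∀ z, z ≠ x → z ≠ y → s z = s' z := by
    rw [← e.forall_congr_right]
    simp
  have h₂ : s ∘ e.symm = s' ∘ e.symm ↔ s = s' := e.symm.surjective.injective_comp_right.eq_iff
  rw [pairTerm, ind_congr h₁, ind_congr h₂]
  simp only [pairTerm, Function.comp_apply, Equiv.symm_apply_apply]

end Pairs

/-! ### The generator on a doubled space -/

section Doubled

variable {P : Type*} {θ : ℕ} {u : ℝ} {f : Fin θ → ℝ}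

theorem sumElim_eq_iff {α β γ : Type*} {a a' : α → γ} {b b' : β → γ} :
    Sum.elim a b = Sum.elim a' b' ↔ a = a' ∧ b = b' :=
  ⟨fun h => ⟨funext fun x => congrFun h (Sum.inl x), funext fun x => congrFun h (Sum.inr x)⟩,
    fun h => by rw [h.1, h.2]⟩

theorem pairTerm_inl_inl (w₁ w₂ : P → ℝ) (x y : P) (a b a' b' : P → Fin θ) :
    pairTerm u f (Sum.elim w₁ w₂) (Sum.inl x) (Sum.inl y) (Sum.elim a b) (Sum.elim a' b') =
      pairTerm u f w₁ x y a a' * ind (b = b') := by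
  have h : (∀ z, z ≠ Sum.inl x → z ≠ Sum.inl y → Sum.elim a b z = Sum.elim a' b' z) ↔
      (∀ z, z ≠ x → z ≠ y → a z = a' z) ∧ b = b' := by
    simp [Sum.forall, funext_iff]
  rw [pairTerm, pairTerm, ind_congr h, ind_congr sumElim_eq_iff, ind_and, ind_and (a = a')]
  simp only [Sum.elim_inl]
  ring

theorem pairTerm_inr_inr (w₁ w₂ : P → ℝ) (x y : P) (a b a' b' : P → Fin θ) :
    pairTerm u f (Sum.elim w₁ w₂) (Sum.inr x) (Sum.inr y) (Sum.elim a b) (Sum.elim a' b') =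
      ind (a = a') * pairTerm u f w₂ x y b b' := by
  have h : (∀ z, z ≠ Sum.inr x → z ≠ Sum.inr y → Sum.elim a b z = Sum.elim a' b' z) ↔
      a = a' ∧ (∀ z, z ≠ x → z ≠ y → b z = b' z) := by
    simp [Sum.forall, funext_iff]
  rw [pairTerm, pairTerm, ind_congr h, ind_congr sumElim_eq_iff, ind_and, ind_and (a = a')]
  simp only [Sum.elim_inr]
  ring

/-- The matrix unit `|p⟩⟨q|` at the site `x`. -/
def siteUnit (x : P) (p q : Fin θ) : Matrix (P → Fin θ) (P → Fin θ) ℝ :=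
  Matrix.of fun a a' => ind (∀ z, z ≠ x → a z = a' z) * (ind (a x = p) * ind (a' x = q))

/-- The transitions across the reflection plane that change the configuration. -/
def crossingTransitions (u : ℝ) (x : P) :
    Matrix ((P → Fin θ) × (P → Fin θ)) ((P → Fin θ) × (P → Fin θ)) ℝ :=
  ∑ p, ∑ q, ind (p ≠ q) •
    ((u / 2) • ((siteUnit x p q + siteUnit x q p) ⊗ₖ (siteUnit x p q + siteUnit x q p)) +
      (1 - 2 * u) • (siteUnit x p q ⊗ₖ siteUnit x p q))

/-- Because the sum runs over ordered pairs, the `u / 2` term yields `u` on both `E_pq ⊗ E_qp`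
(cross) and `E_pq ⊗ E_pq` (double bar); the `1 - 2u` term raises the latter to `1 - u`. -/
theorem crossingTransitions_apply (x : P) (a b a' b' : P → Fin θ) :
    crossingTransitions u x (a, b) (a', b') =
      ind (a x ≠ a' x) * (ind (∀ z, z ≠ x → a z = a' z) * ind (∀ z, z ≠ x → b z = b' z) *
        (u * (ind (b x = a' x) * ind (b' x = a x)) +
          (1 - u) * (ind (b x = a x) * ind (b' x = a' x)))) := by
  set I := ind (∀ z, z ≠ x → a z = a' z)
  set J := ind (∀ z, z ≠ x → b z = b' z)
  let g : Fin θ → Fin θ → ℝ := fun p q => ind (b x = p) * ind (b' x = q)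
  have h : ∀ p q : Fin θ, (ind (p ≠ q) •
    ((u / 2) • ((siteUnit x p q + siteUnit x q p) ⊗ₖ (siteUnit x p q + siteUnit x q p)) +
      (1 - 2 * u) • (siteUnit x p q ⊗ₖ siteUnit x p q))) (a, b) (a', b') =
      ind (p ≠ q) * (I * J * (u / 2 * (g p q + g q p) + (1 - 2 * u) * g p q)) * ind (a' x = q) *
        ind (a x = p) +
      ind (p ≠ q) * (I * J * (u / 2 * (g p q + g q p))) * ind (a x = q) * ind (a' x = p) := by
    intro p q
    simp only [Matrix.smul_apply, Matrix.add_apply, Matrix.kronecker_apply, siteUnit,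
      Matrix.of_apply, smul_eq_mul, g]
    change ind (p ≠ q) * (u / 2 * ((I * _ + I * _) * (J * _ + J * _)) +
      (1 - 2 * u) * (I * _ * (J * _))) = _
    ring
  have hne : ind (a' x ≠ a x) = ind (a x ≠ a' x) := ind_congr ne_comm
  simp only [crossingTransitions, Matrix.sum_apply, h, Finset.sum_add_distrib, ← Finset.sum_mul,
    sum_mul_ind]
  rw [hne]
  simp only [g]
  ring

theorem isReflectionPositive_crossingTransitions {W : Type*} (hu : u ∈ Set.Icc (0 : ℝ) (1 / 2))
    (x : P) : IsReflectionPositive fun _ _ : W => crossingTransitions (θ := θ) u x := by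
  refine .sum _ fun p _ => .sum _ fun q _ => .smul (.add (.smul (.kronecker fun _ => _) ?_)
    (.smul (.kronecker fun _ => _) ?_)) ?_
  · linarith [hu.1]
  · linarith [hu.2]
  · simp only [ind]
    split_ifs <;> simp

/-- The part of the contribution of an edge across the reflection plane that lives on one side. -/
def boundaryTerm (f : Fin θ → ℝ) (x : P) (w : P → ℝ) : (P → Fin θ) → ℝ :=
  fun a => -(f (a x) * w x + 1 / 4 * w x ^ 2)

variable [Fintype P]

/-- The part of the contribution of an edge across the reflection plane that couples the sides. -/
def crossingTerm {ι : Type*} [Fintype ι] (u : ℝ) (f : Fin θ → ℝ) (g : ι → Fin θ → ℝ) (c : ℝ)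
    (x : P) (w₁ w₂ : P → ℝ) : Matrix ((P → Fin θ) × (P → Fin θ)) ((P → Fin θ) × (P → Fin θ)) ℝ :=
  crossingTransitions u x +
    (1 / 2 : ℝ) • (Matrix.diagonal (fun a : P → Fin θ => w₁ x + 2 * f (a x)) ⊗ₖ
      Matrix.diagonal (fun a : P → Fin θ => w₂ x + 2 * f (a x))) +
    ∑ j, Matrix.diagonal (fun a : P → Fin θ => g j (a x)) ⊗ₖ
      Matrix.diagonal (fun a : P → Fin θ => g j (a x)) +
    c • 1

theorem isReflectionPositive_crossingTerm {ι : Type*} [Fintype ι]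
    (hu : u ∈ Set.Icc (0 : ℝ) (1 / 2)) (g : ι → Fin θ → ℝ) {c : ℝ} (hc : 0 ≤ c) (x : P) :
    IsReflectionPositive (crossingTerm u f g c x) := by
  have h₁ := (IsReflectionPositive.kronecker fun w : P → ℝ =>
    Matrix.diagonal fun a : P → Fin θ => w x + 2 * f (a x)).smul (c := 1 / 2) (by norm_num)
  have h₂ := IsReflectionPositive.sum Finset.univ fun j _ =>
    IsReflectionPositive.kronecker fun _ : P → ℝ => Matrix.diagonal fun a : P → Fin θ => g j (a x)
  have h₃ := (IsReflectionPositive.one (T := P → Fin θ) (W := P → ℝ)).smul hc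
  exact (((isReflectionPositive_crossingTransitions hu x).add h₁).add h₂).add h₃

theorem diagonal_apply_ind {S : Type*} [DecidableEq S] (d : S → ℝ) (s s' : S) :
    Matrix.diagonal d s s' = ind (s = s') * d s := by
  rw [Matrix.diagonal_apply, ind]
  split_ifs <;> simp

/-- With `p = a x`, `q = b x`, the mixed terms combine as `2 f(p) f(q) + f(p) w₂ + f(q) w₁ + w₁ w₂ /
2 = ½ (w₁ + 2 f(p)) (w₂ + 2 f(q))`; the factor `1 / 4` in the energy is what makes this square
close. -/
theorem pairTerm_inl_inr {ι : Type*} [Fintype ι] {g : ι → Fin θ → ℝ} {c : ℝ}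
    (hg : ∀ p q, ind (p = q) = 2 * (f p * f q) + ∑ j, g j p * g j q + c)
    (w₁ w₂ : P → ℝ) (x : P) (a b a' b' : P → Fin θ) :
    pairTerm u f (Sum.elim w₁ w₂) (Sum.inl x) (Sum.inr x) (Sum.elim a b) (Sum.elim a' b') =
      ind (a = a') * boundaryTerm f x w₁ a * ind (b = b') +
        ind (a = a') * (ind (b = b') * boundaryTerm f x w₂ b) +
        crossingTerm u f g c x w₁ w₂ (a, b) (a', b') := by
  have hoff : (∀ z, z ≠ Sum.inl x → z ≠ Sum.inr x → Sum.elim a b z = Sum.elim a' b' z) ↔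
      (∀ z, z ≠ x → a z = a' z) ∧ ∀ z, z ≠ x → b z = b' z := by
    simp [Sum.forall]
  have heq : ∀ s s' : P → Fin θ, ind (s = s') = ind (∀ z, z ≠ x → s z = s' z) *
      ind (s x = s' x) := by
    intro s s'
    rw [← ind_and]
    refine ind_congr ⟨fun h => by simp [h], fun h => funext fun z => ?_⟩
    by_cases hz : z = x
    · rw [hz, h.2]
    · exact h.1 z hz
  -- When the left spin does not change, neither does the right one, and crosses and double bars
  -- both demand equal spins; their weights add to `u + (1 - u) = 1`.
  have hdiag : ind (∀ z, z ≠ x → a z = a' z) * ind (∀ z, z ≠ x → b z = b' z) *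
      (u * (ind (a' x = b x) * ind (b' x = a x)) +
        (1 - u) * (ind (a' x = b' x) * ind (a x = b x))) =
      crossingTransitions u x (a, b) (a', b') + ind (a = a') * ind (b = b') * ind (a x = b x) := by
    rw [crossingTransitions_apply, heq a, heq b, ind_congr (eq_comm (a := a' x) (b := b x)),
      ind_congr (eq_comm (a := a' x) (b := b' x)), ind_congr (eq_comm (a := a x) (b := b x))]
    by_cases h : a x = a' x
    · rw [ind_not (not_not.2 h), ind_of h, ← h]
      by_cases h' : b x = a x
      · rw [ind_congr (show b x = b' x ↔ b' x = a x by rw [h', eq_comm])]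
        ring
      · rw [ind_not h']
        ring
    · rw [ind_of h, ind_not h]
      ring
  rw [pairTerm, ind_congr hoff, ind_congr sumElim_eq_iff, ind_and, ind_and, ind_and, ind_and]
  simp only [Sum.elim_inl, Sum.elim_inr]
  rw [hdiag, crossingTerm]
  simp only [Matrix.add_apply, Matrix.smul_apply, Matrix.sum_apply, Matrix.kronecker_apply,
    diagonal_apply_ind, smul_eq_mul, boundaryTerm]
  have hone : (1 : Matrix ((P → Fin θ) × (P → Fin θ)) ((P → Fin θ) × (P → Fin θ)) ℝ)
      (a, b) (a', b') = ind (a = a') * ind (b = b') := by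
    rw [← Matrix.one_kronecker_one, Matrix.kronecker_apply, Matrix.one_apply, Matrix.one_apply]
    simp only [ind]
    congr
  have hsum : ∑ j, ind (a = a') * g j (a x) * (ind (b = b') * g j (b x)) =
      ind (a = a') * ind (b = b') * ∑ j, g j (a x) * g j (b x) := by
    rw [Finset.mul_sum]
    exact Finset.sum_congr rfl fun j _ => by ring
  rw [hone, hsum, hg (a x) (b x)]
  ring

end Doubled

/-! ### Reflection positivity of the partition function -/

section Reflection

variable {V P : Type*} [Fintype V] [DecidableEq V] [Fintype P] [DecidableEq P] {θ : ℕ} {u : ℝ}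
  {f : Fin θ → ℝ}

/-- Spin configurations on a doubled graph are pairs of spin configurations. -/
def splitEquiv (e : P ⊕ P ≃ V) (θ : ℕ) : (V → Fin θ) ≃ (P → Fin θ) × (P → Fin θ) :=
  (Equiv.arrowCongr e.symm (Equiv.refl _)).trans (Equiv.sumArrowEquivProdArrow P P (Fin θ))

omit [Fintype V] [DecidableEq V] [Fintype P] [DecidableEq P] in
theorem splitEquiv_symm (e : P ⊕ P ≃ V) (a b : P → Fin θ) :
    (splitEquiv e θ).symm (a, b) = Sum.elim a b ∘ e.symm := rfl

/-- The part of the generator of a doubled graph that lives on one side. -/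
def halfGenerator (G : SimpleGraph V) (e : P ⊕ P ≃ V) (u : ℝ) (f : Fin θ → ℝ) (w : P → ℝ) :
    Matrix (P → Fin θ) (P → Fin θ) ℝ :=
  Matrix.of fun a a' =>
    1 / 2 * ∑ x, ∑ y, ind (G.Adj (e (.inl x)) (e (.inl y))) * pairTerm u f w x y a a' +
      ∑ x, ind (G.Adj (e (.inl x)) (e (.inr x))) * (ind (a = a') * boundaryTerm f x w a)

/-- The part of the generator of a doubled graph that couples the two sides. -/
def crossingGenerator {ι : Type*} [Fintype ι] (G : SimpleGraph V) (e : P ⊕ P ≃ V) (u : ℝ)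
    (f : Fin θ → ℝ) (g : ι → Fin θ → ℝ) (c : ℝ) (w₁ w₂ : P → ℝ) :
    Matrix ((P → Fin θ) × (P → Fin θ)) ((P → Fin θ) × (P → Fin θ)) ℝ :=
  ∑ x, ind (G.Adj (e (.inl x)) (e (.inr x))) • crossingTerm u f g c x w₁ w₂

omit [DecidableEq P] in
-- Edges within a half act on one tensor factor. Edges between the halves join a site to its mirror
-- image; they occur in both orders, which cancels the `1 / 2` of the sum over ordered pairs.
theorem reindex_generator {ι : Type*} [Fintype ι] (G : SimpleGraph V) [Fintype G.edgeSet]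
    (e : P ⊕ P ≃ V)
    (hG : ∀ x y, G.Adj (e (.inr x)) (e (.inr y)) ↔ G.Adj (e (.inl x)) (e (.inl y)))
    (hc : ∀ x y, G.Adj (e (.inl x)) (e (.inr y)) → x = y)
    {g : ι → Fin θ → ℝ} {c : ℝ}
    (hg : ∀ p q, ind (p = q) = 2 * (f p * f q) + ∑ j, g j p * g j q + c)
    {v : V → ℝ} {w₁ w₂ : P → ℝ} (hv : v ∘ e = Sum.elim w₁ w₂) :
    Matrix.reindex (splitEquiv e θ) (splitEquiv e θ) (generator G u f v) =
      halfGenerator G e u f w₁ ⊗ₖ 1 + 1 ⊗ₖ halfGenerator G e u f w₂ +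
        crossingGenerator G e u f g c w₁ w₂ := by
  ext ⟨a, b⟩ ⟨a', b'⟩
  have hind : ∀ (x y : V) (r : ℝ), (open Classical in if G.Adj x y then r else 0) =
      ind (G.Adj x y) * r := by
    intro x y r
    by_cases h : G.Adj x y <;> simp [ind, h]
  have hone : ∀ s s' : P → Fin θ, (1 : Matrix (P → Fin θ) (P → Fin θ) ℝ) s s' =
      ind (s = s') := by
    intro s s'
    rw [Matrix.one_apply, ind]
    congr
  have hcol : ∀ F : P → P → ℝ, ∑ x, ∑ y, ind (G.Adj (e (.inl x)) (e (.inr y))) * F x y =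
      ∑ x, ind (G.Adj (e (.inl x)) (e (.inr x))) * F x x := by
    intro F
    refine Finset.sum_congr rfl fun x _ => Finset.sum_eq_single x (fun y _ hy => ?_) (by simp)
    rw [ind_not fun h => hy (hc x y h).symm, zero_mul]
  have hcol' : ∀ F : P → P → ℝ, ∑ x, ∑ y, ind (G.Adj (e (.inr x)) (e (.inl y))) * F x y =
      ∑ x, ind (G.Adj (e (.inl x)) (e (.inr x))) * F x x := by
    intro F
    rw [← hcol fun x y => F y x, Finset.sum_comm]
    simp only [G.adj_comm]
  rw [Matrix.reindex_apply, Matrix.submatrix_apply, splitEquiv_symm, splitEquiv_symm,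
    generator_apply]
  simp only [hind]
  rw [← e.sum_comp]
  simp only [← e.sum_comp (fun y => ind (G.Adj _ y) * _), pairTerm_equiv, hv,
    Fintype.sum_sum_type, Finset.sum_add_distrib, hcol, hcol']
  simp only [pairTerm_comm _ (Sum.inr _) (Sum.inl _), pairTerm_inl_inr hg, pairTerm_inl_inl,
    pairTerm_inr_inr, ind_congr (hG _ _)]
  simp only [Matrix.add_apply, Matrix.kronecker_apply, hone, halfGenerator, Matrix.of_apply,
    crossingGenerator, Matrix.sum_apply, Matrix.smul_apply, smul_eq_mul]
  simp only [mul_add, Finset.sum_add_distrib]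
  have h₁ : ∑ x, ∑ y, ind (G.Adj (e (.inl x)) (e (.inl y))) *
      (pairTerm u f w₁ x y a a' * ind (b = b')) =
      (∑ x, ∑ y, ind (G.Adj (e (.inl x)) (e (.inl y))) * pairTerm u f w₁ x y a a') *
        ind (b = b') := by
    simp only [Finset.sum_mul, mul_assoc]
  have h₂ : ∑ x, ind (G.Adj (e (.inl x)) (e (.inr x))) *
      (ind (a = a') * boundaryTerm f x w₁ a * ind (b = b')) =
      (∑ x, ind (G.Adj (e (.inl x)) (e (.inr x))) * (ind (a = a') * boundaryTerm f x w₁ a)) *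
        ind (b = b') := by
    simp only [Finset.sum_mul, mul_assoc]
  have h₃ : ∑ x, ind (G.Adj (e (.inl x)) (e (.inr x))) *
      (ind (a = a') * (ind (b = b') * boundaryTerm f x w₂ b)) =
      ind (a = a') *
        ∑ x, ind (G.Adj (e (.inl x)) (e (.inr x))) * (ind (b = b') * boundaryTerm f x w₂ b) := by
    simp only [Finset.mul_sum, mul_left_comm (ind (a = a'))]
  have h₄ : ∑ x, ∑ y, ind (G.Adj (e (.inl x)) (e (.inl y))) *
      (ind (a = a') * pairTerm u f w₂ x y b b') =
      ind (a = a') *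
        ∑ x, ∑ y, ind (G.Adj (e (.inl x)) (e (.inl y))) * pairTerm u f w₂ x y b b' := by
    simp only [Finset.mul_sum, mul_left_comm (ind (a = a'))]
  linear_combination 1 / 2 * h₁ + h₂ + h₃ + 1 / 2 * h₄

theorem trace_exp_generator_sq_le {ι : Type*} [Fintype ι] (G : SimpleGraph V) [Fintype G.edgeSet]
    (e : P ⊕ P ≃ V)
    (hG : ∀ x y, G.Adj (e (.inr x)) (e (.inr y)) ↔ G.Adj (e (.inl x)) (e (.inl y)))
    (hc : ∀ x y, G.Adj (e (.inl x)) (e (.inr y)) → x = y)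
    {g : ι → Fin θ → ℝ} {c : ℝ} (hc0 : 0 ≤ c)
    (hg : ∀ p q, ind (p = q) = 2 * (f p * f q) + ∑ j, g j p * g j q + c)
    {β : ℝ} (hβ : 0 ≤ β) (hu : u ∈ Set.Icc (0 : ℝ) (1 / 2))
    {v v₁ v₂ : V → ℝ} {w₁ w₂ : P → ℝ} (hv : v ∘ e = Sum.elim w₁ w₂)
    (hv₁ : v₁ ∘ e = Sum.elim w₁ w₁) (hv₂ : v₂ ∘ e = Sum.elim w₂ w₂) :
    (NormedSpace.exp (β • generator G u f v)).trace ^ 2 ≤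
      (NormedSpace.exp (β • generator G u f v₁)).trace *
        (NormedSpace.exp (β • generator G u f v₂)).trace := by
  have hX : IsReflectionPositive fun w₁ w₂ => β • crossingGenerator G e u f g c w₁ w₂ := by
    refine .smul (.sum _ fun x _ => .smul (isReflectionPositive_crossingTerm hu g hc0 x) ?_) hβ
    simp only [ind]
    split_ifs <;> simp
  have h : ∀ {v : V → ℝ} {w₁ w₂ : P → ℝ}, v ∘ e = Sum.elim w₁ w₂ →
      (NormedSpace.exp (β • generator G u f v)).trace = (NormedSpace.exp
        ((β • halfGenerator G e u f w₁) ⊗ₖ 1 + 1 ⊗ₖ (β • halfGenerator G e u f w₂) +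
          β • crossingGenerator G e u f g c w₁ w₂)).trace := by
    intro v w₁ w₂ hv
    rw [Matrix.smul_kronecker, Matrix.kronecker_smul, ← smul_add, ← smul_add,
      ← reindex_generator G e hG hc hg hv, ← trace_exp_reindex (splitEquiv e θ)]
    rfl
  rw [h hv, h hv₁, h hv₂]
  exact trace_exp_sq_le_of_isReflectionPositive (fun w => β • halfGenerator G e u f w) hX w₁ w₂

end Reflection

/-! ### The simplex embedding -/

theorem IsSimplexEmbedding.ind_eq {θ : ℕ} (hθ : 2 ≤ θ)
    {a : Fin θ → EuclideanSpace ℝ (Fin (θ - 1))} (ha : IsSimplexEmbedding a) :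
    ∃ g : Fin (θ - 1) → Fin θ → ℝ, ∀ p q, ind (p = q) =
      2 * (firstComponent hθ a p * firstComponent hθ a q) + ∑ j, g j p * g j q + 1 / (θ : ℝ) := by
  have hθ0 : (θ : ℝ) ≠ 0 := by
    have : θ ≠ 0 := by omega
    exact_mod_cast this
  let j₀ : Fin (θ - 1) := ⟨0, by omega⟩
  -- The Gram matrix is `½ δ - 1 / (2θ)`, so `δ = 2 a_p · a_q + 1 / θ`. The first component is kept
  -- apart for the square with the field; the others are split symmetrically through `√2`.
  refine ⟨fun j p => if j = j₀ then 0 else Real.sqrt 2 * a p j, fun p q => ?_⟩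
  have hinner : inner ℝ (a p) (a q) = a p j₀ * a q j₀ +
      ∑ j ∈ Finset.univ.erase j₀, a p j * a q j := by
    rw [PiLp.inner_apply, ← Finset.add_sum_erase _ _ (Finset.mem_univ j₀)]
    simp [mul_comm]
  have hsum : ∑ j, (if j = j₀ then 0 else Real.sqrt 2 * a p j) *
      (if j = j₀ then 0 else Real.sqrt 2 * a q j) =
      2 * ∑ j ∈ Finset.univ.erase j₀, a p j * a q j := by
    rw [← Finset.add_sum_erase _ _ (Finset.mem_univ j₀), Finset.mul_sum]
    simp only [if_true, zero_mul, zero_add]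
    refine Finset.sum_congr rfl fun j hj => ?_
    rw [if_neg (Finset.ne_of_mem_erase hj), if_neg (Finset.ne_of_mem_erase hj),
      mul_mul_mul_comm, Real.mul_self_sqrt zero_le_two]
  have hval : inner ℝ (a p) (a q) = 1 / 2 * ind (p = q) - 1 / (2 * (θ : ℝ)) := by
    by_cases h : p = q
    · subst h
      rw [real_inner_self_eq_norm_sq, ha.norm_sq, ind_of rfl]
      field_simp
    · rw [ha.inner_eq p q h, ind_not h]
      ring
  rw [hsum]
  change _ = 2 * (a p j₀ * a q j₀) + _ + _
  have h2 : 1 / (θ : ℝ) = 2 * (1 / (2 * (θ : ℝ))) := by field_simp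
  rw [h2]
  linarith

/-! ### Reflections of the torus -/

section Torus

variable {d L : ℕ} {i : Fin d} {m : ZMod L}

theorem reflect_reflect (x : Fin d → ZMod L) : reflect i m (reflect i m x) = x := by
  ext j
  by_cases h : j = i
  · subst h
    simp [reflect]
  · simp [reflect, h]

theorem notMem_leftHalf_of_mem_rightHalf [NeZero L] {x : Fin d → ZMod L}
    (hx : x ∈ rightHalf i m) : x ∉ leftHalf i m := by
  intro hx'
  have h₁ : (m - x i).val < L / 2 := hx'
  have h₂ : (x i - (m + 1)).val < L / 2 := hx
  have h : (((m - x i).val + (x i - (m + 1)).val + 1 : ℕ) : ZMod L) = 0 := by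
    push_cast
    rw [ZMod.natCast_zmod_val, ZMod.natCast_zmod_val]
    ring
  have := Nat.le_of_dvd (by omega) ((ZMod.natCast_eq_zero_iff _ _).1 h)
  omega

theorem reflect_adj {x y : Fin d → ZMod L} (h : (torus d L).Adj x y) :
    (torus d L).Adj (reflect i m x) (reflect i m y) := by
  have key : ∀ x y : Fin d → ZMod L, (∃ j, y = x + Pi.single j 1) →
      (∃ j, reflect i m y = reflect i m x + Pi.single j 1) ∨
        ∃ j, reflect i m x = reflect i m y + Pi.single j 1 := by
    rintro x y ⟨j, rfl⟩
    by_cases hj : j = i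
    · subst hj
      refine Or.inr ⟨j, ?_⟩
      ext k
      by_cases hk : k = j
      · subst hk
        simp [reflect]
        ring
      · simp [reflect, hk]
    · refine Or.inl ⟨j, ?_⟩
      ext k
      by_cases hk : k = i
      · subst hk
        simp [reflect, Ne.symm hj]
      · simp [reflect, hk]
  rw [torus, SimpleGraph.fromRel_adj] at h ⊢
  refine ⟨fun h' => h.1 ?_, ?_⟩
  · rw [← reflect_reflect (i := i) (m := m) x, h', reflect_reflect]
  · rcases h.2 with h' | h'
    · exact key x y h'
    · exact (key y x h').symm

theorem reflect_adj_iff {x y : Fin d → ZMod L} :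
    (torus d L).Adj (reflect i m x) (reflect i m y) ↔ (torus d L).Adj x y :=
  ⟨fun h => by simpa only [reflect_reflect] using reflect_adj (i := i) (m := m) h, reflect_adj⟩

/-- Measure depth `r`, `s` of `x`, `y` from the plane, with `0 ≤ r, s ≤ L / 2 - 1`. An edge between
the halves changes only coordinate `i`, and it crosses at one of the two ends of the half. -/
theorem eq_of_adj_reflect [NeZero L] (hL : Even L) {x y : Fin d → ZMod L}
    (hx : x ∈ leftHalf i m) (hy : y ∈ leftHalf i m) (h : (torus d L).Adj x (reflect i m y)) :
    x = y := by
  have hRy := reflect_mem_rightHalf hy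
  have hne : x i ≠ reflect i m y i := by
    intro h'
    refine notMem_leftHalf_of_mem_rightHalf hRy ?_
    change (m - reflect i m y i).val < L / 2
    rw [← h']
    exact hx
  have hxi : (m - x i).val < L / 2 := hx
  have hyi : (m - y i).val < L / 2 := hy
  have hxe : x i = m - ((m - x i).val : ZMod L) := by
    rw [ZMod.natCast_zmod_val]
    ring
  have hye : y i = m - ((m - y i).val : ZMod L) := by
    rw [ZMod.natCast_zmod_val]
    ring
  have hRi : reflect i m y i = 2 * m + 1 - y i := by simp [reflect]
  have hRj : ∀ j, j ≠ i → reflect i m y j = y j := fun j hj => by simp [reflect, hj]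
  rw [torus, SimpleGraph.fromRel_adj] at h
  have hval : (m - x i).val = (m - y i).val → (∀ j, j ≠ i → x j = reflect i m y j) → x = y := by
    intro h₁ h₂
    ext j
    by_cases hj : j = i
    · subst hj
      rw [hxe, hye, h₁]
    · rw [h₂ j hj, hRj j hj]
  obtain ⟨k, hk⟩ := hL
  rcases h.2 with ⟨j, hj⟩ | ⟨j, hj⟩
  · have hji : j = i := by
      by_contra hji
      exact hne (by rw [hj]; simp [Ne.symm hji])
    subst hji
    refine hval ?_ fun l hl => by rw [hj]; simp [hl]
    have h₁ := congrFun hj j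
    rw [hRi, Pi.add_apply, Pi.single_eq_same] at h₁
    -- Crossing at `m`: `r + s ≡ 0` with `r + s ≤ L - 2` forces `r = s = 0`.
    have h₂ : (((m - x j).val + (m - y j).val : ℕ) : ZMod L) = 0 := by
      push_cast
      rw [ZMod.natCast_zmod_val, ZMod.natCast_zmod_val]
      linear_combination h₁
    have h₃ := (ZMod.natCast_eq_zero_iff _ _).1 h₂
    by_cases h0 : (m - x j).val + (m - y j).val = 0
    · omega
    · have := Nat.le_of_dvd (by omega) h₃
      omega
  · have hji : j = i := by
      by_contra hji
      exact hne (by rw [hj]; simp [Ne.symm hji])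
    subst hji
    refine hval ?_ fun l hl => by rw [hj]; simp [hl]
    have h₁ := congrFun hj j
    rw [Pi.add_apply, Pi.single_eq_same, hRi] at h₁
    -- Crossing at the antipodal plane: `r + s + 2` is a positive multiple of `L` and at most `L`,
    -- so both depths are `L / 2 - 1`.
    have h₂ : (((m - x j).val + (m - y j).val + 2 : ℕ) : ZMod L) = 0 := by
      push_cast
      rw [ZMod.natCast_zmod_val, ZMod.natCast_zmod_val]
      linear_combination -h₁
    have := Nat.le_of_dvd (by omega) ((ZMod.natCast_eq_zero_iff _ _).1 h₂)
    omega

/-- The torus consists of the left half and its reflection. -/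
def halvesEquiv [NeZero L] (hL : Even L) (i : Fin d) (m : ZMod L) :
    (leftHalf i m ⊕ leftHalf i m : Type) ≃ (Fin d → ZMod L) :=
  Equiv.ofBijective (Sum.elim (fun x => x.1) fun x => reflect i m x.1) <| by
    constructor
    · rintro (⟨x, hx⟩ | ⟨x, hx⟩) (⟨y, hy⟩ | ⟨y, hy⟩) h <;>
        simp only [Sum.elim_inl, Sum.elim_inr] at h
      · subst h
        rfl
      · exact absurd (h ▸ hx) (notMem_leftHalf_of_mem_rightHalf (reflect_mem_rightHalf hy))
      · exact absurd (h ▸ hy) (notMem_leftHalf_of_mem_rightHalf (reflect_mem_rightHalf hx))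
      · have : x = y := by
          rw [← reflect_reflect (i := i) (m := m) x, h, reflect_reflect]
        subst this
        rfl
    · intro x
      by_cases hx : x ∈ leftHalf i m
      · exact ⟨Sum.inl ⟨x, hx⟩, rfl⟩
      · exact ⟨Sum.inr ⟨reflect i m x, reflect_mem_leftHalf
          (mem_rightHalf_of_notMem_leftHalf hL hx)⟩, reflect_reflect x⟩

/-- The right copy is parametrised by reflection, so the right field appears reflected; the two
fields of the upper bound thus become the diagonal pairs `(w₁, w₁)` and `(w₂, w₂)`. -/
theorem glue_comp_halvesEquiv [NeZero L] (hL : Even L) (v₁ : leftHalf i m → ℝ)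
    (v₂ : rightHalf i m → ℝ) :
    glue hL v₁ v₂ ∘ halvesEquiv hL i m = Sum.elim v₁ (reflectRight v₂) := by
  ext x
  rcases x with ⟨x, hx⟩ | ⟨x, hx⟩
  · exact dif_pos hx
  · exact dif_neg (notMem_leftHalf_of_mem_rightHalf (reflect_mem_rightHalf hx))

theorem reflectRight_reflectLeft (v₁ : leftHalf i m → ℝ) :
    reflectRight (reflectLeft v₁) = v₁ := by
  ext x
  simp [reflectRight, reflectLeft, reflect_reflect]

end Torus

end RandomLoops

end

/-! ### Conclusion: the trace inequality applied to the torus -/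

theorem mainTheorem9 (d L θ : ℕ) [NeZero L] (hL : Even L) (hθ : 2 ≤ θ)
    (β u : ℝ) (hβ : 0 < β) (hu : u ∈ Set.Icc (0 : ℝ) (1 / 2))
    (a : Fin θ → EuclideanSpace ℝ (Fin (θ - 1))) (ha : RandomLoops.IsSimplexEmbedding a) :
    (∀ v : (Fin d → ZMod L) → ℝ, RandomLoops.torusPartitionFunction hθ β u a v ≠ ⊤) ∧
    ∀ (i : Fin d) (m : ZMod L)
      (v₁ : RandomLoops.leftHalf i m → ℝ) (v₂ : RandomLoops.rightHalf i m → ℝ),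
      RandomLoops.torusPartitionFunction hθ β u a (RandomLoops.glue hL v₁ v₂) ^ 2 ≤
        RandomLoops.torusPartitionFunction hθ β u a
            (RandomLoops.glue hL v₁ (RandomLoops.reflectLeft v₁)) *
          RandomLoops.torusPartitionFunction hθ β u a
            (RandomLoops.glue hL (RandomLoops.reflectRight v₂) v₂) := by
  classical
  have hu1 : u ∈ Set.Icc (0 : ℝ) 1 := ⟨hu.1, hu.2.trans (by norm_num)⟩
  have hZ := fun v : (Fin d → ZMod L) → ℝ => RandomLoops.partitionFunction_eq
    (G := RandomLoops.torus d L) hβ hu1 (RandomLoops.firstComponent hθ a) v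
  simp only [RandomLoops.torusPartitionFunction, hZ]
  refine ⟨fun v => ENNReal.ofReal_ne_top, fun i m v₁ v₂ => ?_⟩
  obtain ⟨g, hg⟩ := ha.ind_eq hθ
  have key := RandomLoops.trace_exp_generator_sq_le (RandomLoops.torus d L)
    (RandomLoops.halvesEquiv hL i m) (fun x y => RandomLoops.reflect_adj_iff)
    (fun x y h => Subtype.ext (RandomLoops.eq_of_adj_reflect hL x.2 y.2 h))
    (by positivity) hg hβ.le hu (RandomLoops.glue_comp_halvesEquiv hL v₁ v₂)
    ((RandomLoops.glue_comp_halvesEquiv hL v₁ _).trans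
      (by rw [RandomLoops.reflectRight_reflectLeft]))
    (RandomLoops.glue_comp_halvesEquiv hL (RandomLoops.reflectRight v₂) v₂)
  have hnn := fun v : (Fin d → ZMod L) → ℝ => RandomLoops.trace_exp_generator_nonneg
    (G := RandomLoops.torus d L) hβ.le hu1 (RandomLoops.firstComponent hθ a) v
  have hexp := (Real.exp_pos (-(Fintype.card (RandomLoops.torus d L).edgeSet * β))).le
  -- Nonnegativity of the traces lets the inequality move between `ℝ` and `ℝ≥0∞`; the Poisson
  -- prefactor appears squared on both sides.
  rw [← ENNReal.ofReal_pow (mul_nonneg hexp (hnn _)),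
    ← ENNReal.ofReal_mul (mul_nonneg hexp (hnn _)), mul_pow, mul_mul_mul_comm, ← sq]
  exact ENNReal.ofReal_le_ofReal (mul_le_mul_of_nonneg_left key (sq_nonneg _))
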